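/- Let $\mathbb D$ be the open unit disc and let $f$ be a bounded analytic function in $\mathbb D$, $f\not\equiv 0$. Let $\mu=\sum_n\delta_{a_n}$ be the zero counting measure of $f$ (the sum over the zeros $a_n$ of $f$ in $\mathbb D$, repeated according to multiplicity). Then $\int_{\mathbb D}(1-|\zeta|)\,d\mu(\zeta)<\infty$, and there are a finite positive Borel measure $\psi$ on $\partial\mathbb D$ and a constant $C\in\mathbb R$ such that $$\log|f(z)|=\int_{\mathbb D}\log\frac{|z-\zeta|}{|1-z\bar\zeta|}\,d\mu(\zeta)-\frac1{2\pi}\int_{\partial\mathbb D}\frac{1-|z|^2}{|\zeta-z|^2}\,d\psi(\zeta)+C,\qquad z\in\mathbb D .$$ For any such $\psi$ let $\lambda$ be the complete measure of $\log|f|$, that is, the measure on $\overline{\mathbb D}$ given by $$\lambda(M)=\int_{\mathbb D\cap M}(1-|\zeta|)\,d\mu(\zeta)+\psi(M\cap\partial\mathbb D)\qquad\text{for Borel sets } M\subset\overline{\mathbb D}.$$ Let $\gamma\in(0,1]$ and $p\in(1,\infty)$, and put $$m_p(r,\log|f|)=\Bigl(\frac1{2\pi}\int_0^{2\pi}\bigl|\log|f(re^{i\theta})|\bigr|^p\,d\theta\Bigr)^{1/p},\qquad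 0<r<1,$$ $$\mathcal C(\varphi,\delta)=\{\zeta\in\overline{\mathbb D}:|\zeta|\ge 1-\delta,\ |\arg\zeta-\varphi|\le\pi\delta\}$$ (arguments modulo $2\pi$). Then $$m_p(r,\log|f|)=O\bigl((1-r)^{\gamma-1}\bigr),\quad r\uparrow1,$$ if and only if $$\Bigl(\int_0^{2\pi}\lambda^p(\mathcal C(\varphi,\delta))\,d\varphi\Bigr)^{1/p}=O(\delta^\gamma),\quad 0<\delta<1,$$ that is, if and only if there is a constant $K$ such that the left-hand side is at most $K\delta^\gamma$ for all $\delta\in(0,1)$. -/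

import Mathlib

open MeasureTheory Filter Topology Asymptotics

noncomputable section

/-- The zeros of `f` in the open unit disc. -/
def discZeros (f : ℂ → ℂ) : Set ℂ := {a | a ∈ Metric.ball (0 : ℂ) 1 ∧ f a = 0}

/-- The Riesz measure `∑ δ_{a}` of `log |f|` for a holomorphic `f` in the open unit disc:
the sum of the point masses at the zeros of `f`, each taken with its multiplicity. -/
def zeroMeasure (f : ℂ → ℂ) : Measure ℂ :=
  Measure.sum fun a : discZeros f => analyticOrderNatAt f (a : ℂ) • Measure.dirac (a : ℂ)

/-- `ψ` is a boundary measure of `log |f|`: a finite positive Borel measure carried by the unit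
circle such that, for some real constant `C`, `log |f|` is the Green potential of its (Blaschke)
zero measure, minus the Poisson integral of `ψ`, plus `C`. At the zeros of `f` both sides are `-∞`,
so that the identity has content only where `f` does not vanish. -/
structure IsBoundaryMeasure (f : ℂ → ℂ) (ψ : Measure ℂ) : Prop where
  finite : IsFiniteMeasure ψ
  carried : ψ (Metric.sphere (0 : ℂ) 1)ᶜ = 0
  blaschke : ∫⁻ ζ, ENNReal.ofReal (1 - ‖ζ‖) ∂(zeroMeasure f) < ⊤
  representation : ∃ C : ℝ, ∀ z ∈ Metric.ball (0 : ℂ) 1, f z ≠ 0 →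
    Real.log ‖f z‖ =
      (∫ ζ, Real.log (‖z - ζ‖ / ‖1 - z * (starRingEnd ℂ) ζ‖) ∂(zeroMeasure f))
        - (1 / (2 * Real.pi)) * (∫ ζ, (1 - ‖z‖ ^ 2) / ‖ζ - z‖ ^ 2 ∂ψ) + C

/-- `Λ` is a complete measure of `log |f|`: `Λ = (1 - |ζ|) dμ(ζ) + ψ`, where `μ` is the zero
measure of `f` and `ψ` is a boundary measure of `log |f|`. -/
def IsCompleteMeasure (f : ℂ → ℂ) (Λ : Measure ℂ) : Prop :=
  ∃ ψ : Measure ℂ, IsBoundaryMeasure f ψ ∧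
    Λ = (zeroMeasure f).withDensity (fun ζ => ENNReal.ofReal (1 - ‖ζ‖)) + ψ

/-- The Carleson box `{ζ : 1 - δ ≤ |ζ| ≤ 1, |arg ζ - φ| ≤ π δ}` (arguments modulo `2π`). -/
def carlesonBox (φ δ : ℝ) : Set ℂ :=
  {ζ | ∃ ρ ∈ Set.Icc (1 - δ) 1, ∃ t ∈ Set.Icc (φ - Real.pi * δ) (φ + Real.pi * δ),
    ζ = (ρ : ℂ) * Complex.exp (t * Complex.I)}

/-- The `p`-th integral mean `m_p(r, log |f|)`. -/
def logMean (p : ℝ) (f : ℂ → ℂ) (r : ℝ) : ℝ :=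
  ((1 / (2 * Real.pi)) *
    ∫ θ in (0 : ℝ)..(2 * Real.pi),
      |Real.log ‖f ((r : ℂ) * Complex.exp (θ * Complex.I))‖| ^ p) ^ (1 / p)

/-- The `L^p` norm over `φ ∈ [0, 2π]` of the `Λ`-measure of the Carleson box at `φ` of size `δ`. -/
def boxMean (p : ℝ) (Λ : Measure ℂ) (δ : ℝ) : ℝ :=
  (∫ φ in (0 : ℝ)..(2 * Real.pi), (Λ.real (carlesonBox φ δ)) ^ p) ^ (1 / p)

end

/-! Write `log |f| = C - v`, where `v` is the Green potential of the zeros (with positive sign) plus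
the Poisson integral of `ψ`. Let `ρ` be the pseudohyperbolic distance and `K(z,ζ) =
(1-|z|²)/|1-zζ̄|²`. The identity `1 - ρ² = K (1-|ζ|²)` gives `K (1-|ζ|)/2 ≤ -log ρ ≤ (4/ε) K ρ^(-ε)
(1-|ζ|)`, and on the unit circle `K` is the Poisson kernel and `ρ = 1`. Hence `v` lies between
constant multiples of `N = ∫ K dΛ` and of `∫ K ρ^(-ε) dΛ`, with `Λ` the complete measure
(`IsBoundaryMeasure.exists_potential`).

From means to boxes: on the box of size `δ` at `φ` the kernel with pole `(1-δ)e^{iφ}` is at least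
`1/(36δ)`, so the measure of the box is at most a multiple of `δ v`
(`measure_carlesonBox_le_kernelIntegral`).

From boxes to means: `K` is dominated by a dyadic sum over boxes of size comparable to `2^j (1-r)`
with weights `4^(-j)/(1-r)`, so the box condition bounds the `L^p` norm of `N`
(`setLIntegral_kernelIntegral_rpow_le`). It remains to absorb the singularity `ρ^(-ε)`. With `ε =
1/(2p)`, Hölder's inequality in the measure `K dΛ` leaves the integrable singularity `ρ^(-1/2)`.
Both `N` and `K` obey a Harnack inequality along arcs of length comparable to `1-r`, so `ρ^(-1/2)`
may be replaced by its average over such an arc, which is bounded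
(`setLIntegral_singularIntegral_rpow_le`).

Existence of `ψ`: the Poisson–Jensen formula on circles of radius `r < 1` expresses `L - log |f|` as
a Poisson integral of a positive density plus a Green sum. Fatou's lemma makes the Green potential
of the unit disc finite, dominated convergence identifies the limit of the Green sums, and a weak
limit of the densities is `ψ`. -/

/-! ### Pseudohyperbolic distance and the kernel: pointwise estimates. -/

/-- The pseudohyperbolic distance in the unit disc. -/
noncomputable def pseudoDist (z ζ : ℂ) : ℝ := ‖z - ζ‖ / ‖1 - z * (starRingEnd ℂ) ζ‖

/-- The kernel `(1 - |z|²) / |1 - z ζ̄|²`, which is the Poisson kernel when `ζ` is unimodular. -/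
noncomputable def boxKernel (z ζ : ℂ) : ℝ := (1 - ‖z‖ ^ 2) / ‖1 - z * (starRingEnd ℂ) ζ‖ ^ 2

lemma normSq_one_sub_mul_conj (z ζ : ℂ) :
    ‖1 - z * (starRingEnd ℂ) ζ‖ ^ 2 = ‖z - ζ‖ ^ 2 + (1 - ‖z‖ ^ 2) * (1 - ‖ζ‖ ^ 2) := by
  simp only [← Complex.normSq_eq_norm_sq, Complex.normSq_apply]
  simp
  ring

lemma one_sub_le_norm_one_sub_mul_conj {z ζ : ℂ} (hζ : ‖ζ‖ ≤ 1) :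
    1 - ‖z‖ ≤ ‖1 - z * (starRingEnd ℂ) ζ‖ := by
  have h1 : ‖(1 : ℂ)‖ - ‖z * (starRingEnd ℂ) ζ‖ ≤ ‖1 - z * (starRingEnd ℂ) ζ‖ :=
    norm_sub_norm_le _ _
  have h2 : ‖z * (starRingEnd ℂ) ζ‖ ≤ ‖z‖ := by
    rw [norm_mul, RCLike.norm_conj]
    exact mul_le_of_le_one_right (norm_nonneg _) hζ
  rw [norm_one] at h1
  linarith

lemma one_sub_le_norm_one_sub_mul_conj' {z ζ : ℂ} (hz : ‖z‖ ≤ 1) :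
    1 - ‖ζ‖ ≤ ‖1 - z * (starRingEnd ℂ) ζ‖ := by
  have h1 : ‖(1 : ℂ)‖ - ‖z * (starRingEnd ℂ) ζ‖ ≤ ‖1 - z * (starRingEnd ℂ) ζ‖ :=
    norm_sub_norm_le _ _
  have h2 : ‖z * (starRingEnd ℂ) ζ‖ ≤ ‖ζ‖ := by
    rw [norm_mul, RCLike.norm_conj]
    exact mul_le_of_le_one_left (norm_nonneg _) hz
  rw [norm_one] at h1
  linarith

lemma norm_one_sub_mul_conj_le_two {z ζ : ℂ} (hz : ‖z‖ ≤ 1) (hζ : ‖ζ‖ ≤ 1) :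
    ‖1 - z * (starRingEnd ℂ) ζ‖ ≤ 2 := by
  have h1 : ‖1 - z * (starRingEnd ℂ) ζ‖ ≤ ‖(1 : ℂ)‖ + ‖z * (starRingEnd ℂ) ζ‖ := norm_sub_le _ _
  have h2 : ‖z * (starRingEnd ℂ) ζ‖ ≤ 1 := by
    rw [norm_mul, RCLike.norm_conj]
    exact mul_le_one₀ hz (norm_nonneg _) hζ
  rw [norm_one] at h1
  linarith

lemma norm_one_sub_mul_conj_pos {z ζ : ℂ} (hz : ‖z‖ < 1) (hζ : ‖ζ‖ ≤ 1) :
    0 < ‖1 - z * (starRingEnd ℂ) ζ‖ :=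
  lt_of_lt_of_le (by linarith) (one_sub_le_norm_one_sub_mul_conj (z := z) hζ)

lemma pseudoDist_nonneg (z ζ : ℂ) : 0 ≤ pseudoDist z ζ := by unfold pseudoDist; positivity

lemma boxKernel_nonneg {z : ℂ} (hz : ‖z‖ ≤ 1) (ζ : ℂ) : 0 ≤ boxKernel z ζ := by
  have : ‖z‖ ^ 2 ≤ 1 := pow_le_one₀ (norm_nonneg _) hz
  unfold boxKernel
  exact div_nonneg (by linarith) (by positivity)

lemma one_sub_pseudoDist_sq {z ζ : ℂ} (hz : ‖z‖ < 1) (hζ : ‖ζ‖ ≤ 1) :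
    1 - pseudoDist z ζ ^ 2 = boxKernel z ζ * (1 - ‖ζ‖ ^ 2) := by
  have h := norm_one_sub_mul_conj_pos hz hζ
  have h2 := normSq_one_sub_mul_conj z ζ
  unfold pseudoDist boxKernel
  rw [div_pow, div_mul_eq_mul_div, eq_div_iff (by positivity), sub_mul,
    div_mul_cancel₀ _ (by positivity)]
  linarith

lemma pseudoDist_le_one {z ζ : ℂ} (hz : ‖z‖ < 1) (hζ : ‖ζ‖ ≤ 1) : pseudoDist z ζ ≤ 1 := by
  have h := one_sub_pseudoDist_sq hz hζ
  have h1 : 0 ≤ boxKernel z ζ * (1 - ‖ζ‖ ^ 2) :=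
    mul_nonneg (boxKernel_nonneg hz.le ζ) (by nlinarith [norm_nonneg ζ])
  nlinarith [pseudoDist_nonneg z ζ]

lemma boxKernel_mul_le_neg_log {z ζ : ℂ} (hz : ‖z‖ < 1) (hζ : ‖ζ‖ ≤ 1) (hne : z ≠ ζ) :
    boxKernel z ζ * (1 - ‖ζ‖) / 2 ≤ -Real.log (pseudoDist z ζ) := by
  have hpos : 0 < pseudoDist z ζ :=
    div_pos (norm_pos_iff.mpr (sub_ne_zero.mpr hne)) (norm_one_sub_mul_conj_pos hz hζ)
  have h1 := Real.log_le_sub_one_of_pos (pow_pos hpos 2)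
  have h2 := one_sub_pseudoDist_sq hz hζ
  rw [Real.log_pow] at h1
  push_cast at h1
  have h3 : boxKernel z ζ * (1 - ‖ζ‖) ≤ boxKernel z ζ * (1 - ‖ζ‖ ^ 2) :=
    mul_le_mul_of_nonneg_left (by nlinarith [norm_nonneg ζ]) (boxKernel_nonneg hz.le ζ)
  linarith

/-- Near `ρ = 1` the logarithm is comparable to `1 - ρ²`; near `0` it is at most `ρ^(-ε)/ε`, while
`1 - ρ²` is bounded below. The product of the two majorants serves both ranges. -/
lemma neg_log_le_rpow_mul {ε ρ : ℝ} (hε : 0 < ε) (hε1 : ε ≤ 1 / 2) (h0 : 0 < ρ) (h1 : ρ ≤ 1) :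
    -Real.log ρ ≤ 2 / ε * (1 - ρ ^ 2) * ρ ^ (-ε) := by
  have hA : 1 ≤ ρ ^ (-ε) := Real.one_le_rpow_of_pos_of_le_one_of_nonpos h0 h1 (by linarith)
  rcases le_total (1 / 2) ρ with h | h
  · have h2 := Real.log_le_sub_one_of_pos (inv_pos.mpr h0)
    rw [Real.log_inv] at h2
    have h3 : ρ⁻¹ - 1 ≤ 2 * (1 - ρ ^ 2) := by
      have : ρ⁻¹ ≤ 2 := by
        rw [inv_le_comm₀ h0 two_pos]; linarith
      have e : ρ⁻¹ - 1 = ρ⁻¹ * (1 - ρ) := by field_simp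
      rw [e]
      nlinarith [mul_le_mul_of_nonneg_right this (sub_nonneg.mpr h1)]
    have h4 : 2 ≤ 2 / ε := by rw [le_div_iff₀ hε]; linarith
    have h5 : 0 ≤ 1 - ρ ^ 2 := by nlinarith
    calc -Real.log ρ ≤ 2 * (1 - ρ ^ 2) := by linarith
      _ ≤ 2 / ε * (1 - ρ ^ 2) := by gcongr
      _ ≤ 2 / ε * (1 - ρ ^ 2) * ρ ^ (-ε) := le_mul_of_one_le_right (by positivity) hA
  · have h2 := Real.log_le_rpow_div (inv_nonneg.mpr h0.le) hε
    rw [Real.log_inv, Real.inv_rpow h0.le, ← Real.rpow_neg h0.le] at h2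
    have h5 : 1 / 2 ≤ 1 - ρ ^ 2 := by nlinarith
    calc -Real.log ρ ≤ ρ ^ (-ε) / ε := h2
      _ = 2 / ε * (1 / 2) * ρ ^ (-ε) := by ring
      _ ≤ _ := by gcongr

lemma neg_log_pseudoDist_le {ε : ℝ} (hε : 0 < ε) (hε1 : ε ≤ 1 / 2) {z ζ : ℂ} (hz : ‖z‖ < 1)
    (hζ : ‖ζ‖ ≤ 1) (hne : z ≠ ζ) :
    -Real.log (pseudoDist z ζ) ≤
      4 / ε * boxKernel z ζ * (pseudoDist z ζ) ^ (-ε) * (1 - ‖ζ‖) := by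
  have hpos : 0 < pseudoDist z ζ :=
    div_pos (norm_pos_iff.mpr (sub_ne_zero.mpr hne)) (norm_one_sub_mul_conj_pos hz hζ)
  refine (neg_log_le_rpow_mul hε hε1 hpos (pseudoDist_le_one hz hζ)).trans ?_
  rw [one_sub_pseudoDist_sq hz hζ]
  have h3 : boxKernel z ζ * (1 - ‖ζ‖ ^ 2) ≤ 2 * (boxKernel z ζ * (1 - ‖ζ‖)) := by
    have := mul_le_mul_of_nonneg_left
      (show 1 - ‖ζ‖ ^ 2 ≤ 2 * (1 - ‖ζ‖) by nlinarith [norm_nonneg ζ]) (boxKernel_nonneg hz.le ζ)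
    linarith
  calc 2 / ε * (boxKernel z ζ * (1 - ‖ζ‖ ^ 2)) * pseudoDist z ζ ^ (-ε)
      ≤ 2 / ε * (2 * (boxKernel z ζ * (1 - ‖ζ‖))) * pseudoDist z ζ ^ (-ε) := by gcongr
    _ = _ := by ring

lemma measurable_pseudoDist : Measurable fun q : ℂ × ℂ => pseudoDist q.1 q.2 := by
  unfold pseudoDist; fun_prop

lemma measurable_boxKernel : Measurable fun q : ℂ × ℂ => boxKernel q.1 q.2 := by
  unfold boxKernel; fun_prop

/-! ### Carleson boxes and the size of `1 - z ζ̄`. -/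

/-- All boxes of one size are rotations of a single compact set. This yields measurability of each
box and, jointly in the angle, of its measure. -/
lemma carlesonBox_eq_image (φ δ : ℝ) :
    carlesonBox φ δ = (fun ζ : ℂ => ζ * Complex.exp (-(φ * Complex.I))) ⁻¹'
      ((fun q : ℝ × ℝ => (q.1 : ℂ) * Complex.exp (q.2 * Complex.I)) ''
        (Set.Icc (1 - δ) 1 ×ˢ Set.Icc (-(Real.pi * δ)) (Real.pi * δ))) := by
  ext ζ
  simp only [carlesonBox, Set.mem_ofPred_eq, Set.mem_preimage, Set.mem_image, Set.mem_prod,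
    Prod.exists]
  constructor
  · rintro ⟨ρ, hρ, t, ht, rfl⟩
    refine ⟨ρ, t - φ, ⟨hρ, by constructor <;> linarith [ht.1, ht.2]⟩, ?_⟩
    rw [mul_assoc, ← Complex.exp_add]
    push_cast
    ring_nf
  · rintro ⟨ρ, t, ⟨hρ, ht⟩, h⟩
    refine ⟨ρ, hρ, t + φ, by constructor <;> linarith [ht.1, ht.2], ?_⟩
    have : ζ = ζ * Complex.exp (-(φ * Complex.I)) * Complex.exp (φ * Complex.I) := by
      rw [mul_assoc, ← Complex.exp_add]; simp
    rw [this, ← h, mul_assoc, ← Complex.exp_add]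
    push_cast
    ring_nf

lemma isCompact_standardBox (δ : ℝ) :
    IsCompact ((fun q : ℝ × ℝ => (q.1 : ℂ) * Complex.exp (q.2 * Complex.I)) ''
        (Set.Icc (1 - δ) 1 ×ˢ Set.Icc (-(Real.pi * δ)) (Real.pi * δ))) :=
  (isCompact_Icc.prod isCompact_Icc).image (by fun_prop)

lemma measurableSet_carlesonBox (φ δ : ℝ) : MeasurableSet (carlesonBox φ δ) := by
  rw [carlesonBox_eq_image]
  exact (isCompact_standardBox δ).isClosed.measurableSet.preimage (by fun_prop)

lemma measurable_measure_carlesonBox (Λ : Measure ℂ) [SFinite Λ] (δ : ℝ) :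
    Measurable fun φ => Λ (carlesonBox φ δ) := by
  have h : MeasurableSet {q : ℝ × ℂ | q.2 ∈ carlesonBox q.1 δ} := by
    simp only [carlesonBox_eq_image, Set.mem_preimage]
    exact (isCompact_standardBox δ).isClosed.measurableSet.preimage
      (f := fun q : ℝ × ℂ => q.2 * Complex.exp (-(q.1 * Complex.I))) (by fun_prop)
  exact measurable_measure_prodMk_left h

lemma norm_one_sub_exp_le (x : ℝ) : ‖1 - Complex.exp (x * Complex.I)‖ ≤ |x| := by
  rw [norm_sub_rev]
  have := Real.norm_exp_I_mul_ofReal_sub_one_le (x := x)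
  rwa [mul_comm Complex.I, Real.norm_eq_abs] at this

/-- The radial displacement contributes at most `2δ` and the angular one at most `πδ ≤ 4δ`. -/
lemma norm_one_sub_mul_conj_le_of_mem_carlesonBox {φ δ : ℝ} (hδ0 : 0 ≤ δ) (hδ : δ ≤ 1) {ζ : ℂ}
    (h : ζ ∈ carlesonBox φ δ) :
    ‖1 - ((1 - δ : ℝ) : ℂ) * Complex.exp (φ * Complex.I) * (starRingEnd ℂ) ζ‖ ≤ 6 * δ := by
  obtain ⟨ρ, hρ, t, ht, rfl⟩ := h
  have e : ((1 - δ : ℝ) : ℂ) * Complex.exp (φ * Complex.I) *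
      (starRingEnd ℂ) ((ρ : ℂ) * Complex.exp (t * Complex.I)) =
      (((1 - δ) * ρ : ℝ) : ℂ) * Complex.exp ((φ - t : ℝ) * Complex.I) := by
    rw [map_mul, Complex.conj_ofReal, ← Complex.exp_conj, map_mul, Complex.conj_I,
      Complex.conj_ofReal]
    push_cast
    rw [show ((φ : ℂ) - t) * Complex.I = φ * Complex.I + t * (-Complex.I) by ring, Complex.exp_add]
    ring
  rw [e]
  have h0 : 0 ≤ (1 - δ) * ρ := mul_nonneg (by linarith) (by linarith [hρ.1])
  have h1 : (1 - δ) * ρ ≤ 1 := mul_le_one₀ (by linarith) (by linarith [hρ.1]) hρ.2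
  have h2 : 1 - 2 * δ ≤ (1 - δ) * ρ := by nlinarith [hρ.1]
  have e2 : (1 : ℂ) - (((1 - δ) * ρ : ℝ) : ℂ) * Complex.exp ((φ - t : ℝ) * Complex.I) =
      ((1 - (1 - δ) * ρ : ℝ) : ℂ) +
        (((1 - δ) * ρ : ℝ) : ℂ) * (1 - Complex.exp ((φ - t : ℝ) * Complex.I)) := by
    push_cast; ring
  rw [e2]
  refine (norm_add_le _ _).trans ?_
  rw [norm_mul, Complex.norm_real, Complex.norm_real, Real.norm_of_nonneg h0,
    Real.norm_of_nonneg (by linarith)]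
  have h3 : |φ - t| ≤ Real.pi * δ := abs_le.mpr ⟨by linarith [ht.2], by linarith [ht.1]⟩
  have h4 := (norm_one_sub_exp_le (φ - t)).trans h3
  have h5 := mul_le_mul h1 h4 (norm_nonneg _) zero_le_one
  have h6 : Real.pi * δ ≤ 4 * δ := mul_le_mul_of_nonneg_right Real.pi_le_four hδ0
  linarith

lemma mem_carlesonBox_of_one_le {φ δ : ℝ} (hδ : 1 ≤ δ) {ζ : ℂ} (hζ : ‖ζ‖ ≤ 1) :
    ζ ∈ carlesonBox φ δ := by
  rw [carlesonBox_eq_image]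
  set w := ζ * Complex.exp (-(φ * Complex.I)) with hw
  have hn : ‖w‖ = ‖ζ‖ := by
    rw [hw, norm_mul, ← neg_mul, ← Complex.ofReal_neg, Complex.norm_exp_ofReal_mul_I, mul_one]
  have hpi := Real.pi_pos
  refine ⟨(‖w‖, w.arg), ⟨⟨by linarith [norm_nonneg w], by rw [hn]; exact hζ⟩,
    ⟨by nlinarith [Complex.neg_pi_lt_arg w], by nlinarith [Complex.arg_le_pi w]⟩⟩, ?_⟩
  exact Complex.norm_mul_exp_arg_mul_I w

/-- For `s ≥ 1/2` the box is the whole disc. Otherwise rotate to `φ = 0`: then `r w` lies within `s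
< 1/2` of `1`, so `w` is in the right half plane, `r |w| > 1/2`, and the imaginary part bounds `|sin
(arg w)|` by `2s`; Jordan's inequality turns this into a bound for the argument. -/
lemma mem_carlesonBox_of_norm_le {φ r s : ℝ} (hr0 : 0 ≤ r) (hr : r ≤ 1) {ζ : ℂ} (hζ : ‖ζ‖ ≤ 1)
    (h : ‖1 - (r : ℂ) * Complex.exp (φ * Complex.I) * (starRingEnd ℂ) ζ‖ ≤ s) :
    ζ ∈ carlesonBox φ (2 * s) := by
  rcases le_or_gt (1 / 2) s with hs | hs
  · exact mem_carlesonBox_of_one_le (by linarith) hζ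
  rw [carlesonBox_eq_image]
  set w := ζ * Complex.exp (-(φ * Complex.I)) with hw
  have hn : ‖w‖ = ‖ζ‖ := by
    rw [hw, norm_mul, ← neg_mul, ← Complex.ofReal_neg, Complex.norm_exp_ofReal_mul_I, mul_one]
  have hz1 : ‖(r : ℂ) * Complex.exp (φ * Complex.I)‖ ≤ 1 := by
    rw [norm_mul, Complex.norm_exp_ofReal_mul_I, Complex.norm_real, Real.norm_of_nonneg hr0]
    linarith
  have h1 := (one_sub_le_norm_one_sub_mul_conj' (ζ := ζ) hz1).trans h
  have e : (r : ℂ) * Complex.exp (φ * Complex.I) * (starRingEnd ℂ) ζ =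
      (starRingEnd ℂ) ((r : ℂ) * w) := by
    rw [hw, map_mul, map_mul, ← Complex.exp_conj, map_neg, map_mul, Complex.conj_I,
      Complex.conj_ofReal, Complex.conj_ofReal]
    ring_nf
  have h2 : ‖1 - (r : ℂ) * w‖ ≤ s := by
    rw [e, ← map_one (starRingEnd ℂ), ← map_sub, RCLike.norm_conj] at h
    exact h
  have hs0 : 0 ≤ s := (norm_nonneg _).trans h2
  have hre : 1 - r * w.re ≤ s := by
    have := (Complex.re_le_norm (1 - (r : ℂ) * w)).trans h2
    simpa using this
  have him : r * |w.im| ≤ s := by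
    have := (Complex.abs_im_le_norm (1 - (r : ℂ) * w)).trans h2
    simpa [abs_mul, abs_of_nonneg hr0] using this
  have hrw : 1 / 2 < r * w.re := by linarith
  have hrpos : 0 < r := by
    rcases hr0.eq_or_lt with h | h
    · rw [← h] at hrw; norm_num at hrw
    · exact h
  have hwre : 0 < w.re := by
    by_contra hcon
    nlinarith
  have harg : |w.arg| < Real.pi / 2 := Complex.abs_arg_lt_pi_div_two_iff.mpr (Or.inl hwre)
  have hpi := Real.pi_pos
  have hrn : 1 / 2 < r * ‖w‖ :=
    hrw.trans_le (mul_le_mul_of_nonneg_left (Complex.re_le_norm w) hr0)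
  have hsin : |Real.sin w.arg| * (r * ‖w‖) ≤ s := by
    have : ‖w‖ * |Real.sin w.arg| = |w.im| := by
      rw [← Complex.norm_mul_sin_arg, abs_mul, abs_norm]
    calc |Real.sin w.arg| * (r * ‖w‖) = r * (‖w‖ * |Real.sin w.arg|) := by ring
      _ ≤ s := by rw [this]; exact him
  have hsin2 : |Real.sin w.arg| ≤ 2 * s := by nlinarith [abs_nonneg (Real.sin w.arg)]
  have hj := Real.mul_abs_le_abs_sin harg.le
  have hfin : |w.arg| ≤ Real.pi * (2 * s) := by
    have : |w.arg| = Real.pi / 2 * (2 / Real.pi * |w.arg|) := by field_simp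
    rw [this]
    calc Real.pi / 2 * (2 / Real.pi * |w.arg|) ≤ Real.pi / 2 * (2 * s) :=
          mul_le_mul_of_nonneg_left (hj.trans hsin2) (by positivity)
      _ ≤ Real.pi * (2 * s) := by gcongr; linarith
  refine ⟨(‖w‖, w.arg), ⟨⟨by rw [hn]; linarith, by rw [hn]; exact hζ⟩,
    abs_le.mp hfin⟩, ?_⟩
  exact Complex.norm_mul_exp_arg_mul_I w

/-! ### Points on circles. -/

/-- The point with polar coordinates `r` and `φ`. -/
noncomputable def polarPt (r φ : ℝ) : ℂ := (r : ℂ) * Complex.exp (φ * Complex.I)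

lemma norm_polarPt {r : ℝ} (hr : 0 ≤ r) (φ : ℝ) : ‖polarPt r φ‖ = r := by
  rw [polarPt, norm_mul, Complex.norm_exp_ofReal_mul_I, Complex.norm_real, Real.norm_of_nonneg hr,
    mul_one]

lemma polarPt_add_two_pi (r φ : ℝ) : polarPt r (φ + 2 * Real.pi) = polarPt r φ := by
  unfold polarPt
  push_cast
  rw [add_mul, Complex.exp_add, Complex.exp_two_pi_mul_I, mul_one]

lemma continuous_polarPt (r : ℝ) : Continuous (polarPt r) := by unfold polarPt; fun_prop

lemma norm_polarPt_sub {r : ℝ} (hr : 0 ≤ r) (φ s : ℝ) :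
    ‖polarPt r φ - polarPt r (φ + s)‖ = r * ‖1 - Complex.exp (s * Complex.I)‖ := by
  have : polarPt r φ - polarPt r (φ + s) = polarPt r φ * (1 - Complex.exp (s * Complex.I)) := by
    unfold polarPt
    push_cast
    rw [add_mul, Complex.exp_add]
    ring
  rw [this, norm_mul, norm_polarPt hr]

lemma two_div_pi_mul_abs_le {x : ℝ} (hx : |x| ≤ Real.pi) :
    2 / Real.pi * |x| ≤ ‖1 - Complex.exp (x * Complex.I)‖ := by
  rw [norm_sub_rev, mul_comm (x : ℂ), Complex.norm_exp_I_mul_ofReal_sub_one, norm_mul,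
    Real.norm_eq_abs, Real.norm_eq_abs, abs_two]
  have := Real.mul_abs_le_abs_sin (x := x / 2) (by rw [abs_div, abs_two]; linarith)
  rw [abs_div, abs_two] at this
  linarith

/-! ### Averaging over short arcs, and Hölder's inequality with a weight. -/

section Periodic

variable {G F R : ℝ → ENNReal}

lemma setLIntegral_period_comp_add (hper : ∀ x, G (x + 2 * Real.pi) = G x) (hG : Measurable G)
    (s : ℝ) :
    ∫⁻ x in Set.Ioc 0 (2 * Real.pi), G (x + s) = ∫⁻ x in Set.Ioc 0 (2 * Real.pi), G x := by
  have h := (measurePreserving_add_right (volume : Measure ℝ) s).setLIntegral_comp_preimage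
    (s := Set.Ioc s (s + 2 * Real.pi)) measurableSet_Ioc hG
  have e : (fun x : ℝ => x + s) ⁻¹' Set.Ioc s (s + 2 * Real.pi) = Set.Ioc 0 (2 * Real.pi) := by
    ext x
    simp only [Set.mem_preimage, Set.mem_Ioc]
    constructor <;> rintro ⟨h1, h2⟩ <;> constructor <;> linarith
  rw [e] at h
  rw [h]
  have h0 := isAddFundamentalDomain_Ioc Real.two_pi_pos 0
  rw [zero_add] at h0
  refine (isAddFundamentalDomain_Ioc Real.two_pi_pos s).setLIntegral_eq h0 G ?_
  rintro ⟨g, hg⟩ x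
  obtain ⟨n, rfl⟩ := AddSubgroup.mem_zmultiples_iff.mp hg
  have hp : Function.Periodic G (2 * Real.pi) := hper
  change G (n • (2 * Real.pi) + x) = G x
  rw [add_comm]
  exact hp.zsmul n x

/-- A factor `F` that is almost constant at scale `δ` does not see the difference between `R` and
its average over arcs of half-length `δ`. Replace `F φ` by `A * F (φ + s)`, translate so that the
shift falls on `R`, and integrate over `s` first. -/
lemma setLIntegral_mul_le_of_harnack {δ : ℝ} {A D : ENNReal}
    (hF : Measurable F) (hR : Measurable R)
    (hFper : ∀ x, F (x + 2 * Real.pi) = F x) (hRper : ∀ x, R (x + 2 * Real.pi) = R x)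
    (hH : ∀ φ s, |s| ≤ δ → F φ ≤ A * F (φ + s))
    (hD : ∀ a, ∫⁻ s in Set.Icc (-δ) δ, R (a - s) ≤ D) :
    ENNReal.ofReal (2 * δ) * ∫⁻ φ in Set.Ioc 0 (2 * Real.pi), F φ * R φ ≤
      A * D * ∫⁻ φ in Set.Ioc 0 (2 * Real.pi), F φ := by
  set I := Set.Ioc 0 (2 * Real.pi)
  have hm : Measurable fun q : ℝ × ℝ => F q.2 * R (q.2 - q.1) :=
    (hF.comp measurable_snd).mul (hR.comp (measurable_snd.sub measurable_fst))
  calc ENNReal.ofReal (2 * δ) * ∫⁻ φ in I, F φ * R φ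
      = ∫⁻ _ in Set.Icc (-δ) δ, ∫⁻ φ in I, F φ * R φ := by
        rw [setLIntegral_const, Real.volume_Icc, mul_comm]; ring_nf
    _ ≤ ∫⁻ s in Set.Icc (-δ) δ, ∫⁻ φ in I, A * (F φ * R (φ - s)) := by
        refine setLIntegral_mono' measurableSet_Icc fun s hs => ?_
        calc ∫⁻ φ in I, F φ * R φ
            ≤ ∫⁻ φ in I, A * (F (φ + s) * R (φ + s - s)) := by
              refine lintegral_mono fun φ => ?_
              rw [add_sub_cancel_right, ← mul_assoc]
              exact mul_le_mul_left (hH φ s (abs_le.mpr hs)) _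
          _ = _ := by
              refine setLIntegral_period_comp_add (G := fun φ => A * (F φ * R (φ - s)))
                (fun x => ?_) ?_ s
              · simp only [hFper, add_sub_right_comm, hRper]
              · exact measurable_const.mul (hF.mul (hR.comp (measurable_id.sub measurable_const)))
    _ = ∫⁻ φ in I, ∫⁻ s in Set.Icc (-δ) δ, A * (F φ * R (φ - s)) :=
        lintegral_lintegral_swap (measurable_const.mul hm).aemeasurable
    _ ≤ ∫⁻ φ in I, A * D * F φ := by
        refine lintegral_mono fun φ => ?_
        have hm2 : Measurable fun s => R (φ - s) := hR.comp (measurable_const.sub measurable_id)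
        rw [lintegral_const_mul _ (hm2.const_mul _), lintegral_const_mul _ hm2, mul_assoc,
          mul_comm D]
        exact mul_le_mul_right (mul_le_mul_right (hD φ) _) _
    _ = _ := lintegral_const_mul _ hF

end Periodic

/-- Hölder's inequality after splitting `k = k^(1/q) * k^(1/p)`. It is used with `k` the kernel and
`μ = Λ`, and with `k = 2^(-j)` and counting measure. -/
lemma lintegral_mul_rpow_le {α : Type*} [MeasurableSpace α] (μ : Measure α) {p : ℝ} (hp : 1 < p)
    {k g : α → ENNReal} (hk : Measurable k) (hg : Measurable g) :
    (∫⁻ a, k a * g a ∂μ) ^ p ≤ (∫⁻ a, k a ∂μ) ^ (p - 1) * ∫⁻ a, k a * g a ^ p ∂μ := by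
  have hpq := Real.HolderConjugate.conjExponent hp
  set q := p.conjExponent
  have hp0 : 0 < p := by linarith
  have hq0 : 0 < q := hpq.symm.pos
  have hsum : 1 / q + 1 / p = 1 := by
    have := hpq.inv_add_inv_eq_one
    rw [one_div, one_div]; linarith
  have h := ENNReal.lintegral_mul_le_Lp_mul_Lq μ hpq.symm (f := fun a => k a ^ (1 / q))
    (g := fun a => k a ^ (1 / p) * g a) (hk.pow_const _).aemeasurable
    ((hk.pow_const _).mul hg).aemeasurable
  have e1 : ∀ a, ((fun a => k a ^ (1 / q)) * fun a => k a ^ (1 / p) * g a) a = k a * g a := by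
    intro a
    rw [Pi.mul_apply, ← mul_assoc, ← ENNReal.rpow_add_of_nonneg _ _ (by positivity) (by positivity),
      hsum, ENNReal.rpow_one]
  have e2 : ∀ a, (k a ^ (1 / q)) ^ q = k a := by
    intro a
    rw [← ENNReal.rpow_mul, one_div_mul_cancel hq0.ne', ENNReal.rpow_one]
  have e3 : ∀ a, (k a ^ (1 / p) * g a) ^ p = k a * g a ^ p := by
    intro a
    rw [ENNReal.mul_rpow_of_nonneg _ _ hp0.le, ← ENNReal.rpow_mul, one_div_mul_cancel hp0.ne',
      ENNReal.rpow_one]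
  simp only [e1, e2, e3] at h
  have h2 := ENNReal.rpow_le_rpow h hp0.le
  rw [ENNReal.mul_rpow_of_nonneg _ _ hp0.le, ← ENNReal.rpow_mul, ← ENNReal.rpow_mul,
    one_div_mul_cancel hp0.ne', ENNReal.rpow_one] at h2
  have : 1 / q * p = p - 1 := by
    have : 1 / q = 1 - 1 / p := by linarith
    rw [this, sub_mul, one_div_mul_cancel hp0.ne', one_mul]
  rwa [this] at h2

/-! ### The singularity `ρ^(-1/2)` is bounded on average over arcs. -/

lemma setLIntegral_rpow_neg_half_Ioc {b c : ℝ} (hb : 0 < b) (hc : 0 < c) :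
    ∫⁻ t in Set.Ioc 0 b, ENNReal.ofReal (|t| / c) ^ (-(1 / 2) : ℝ) =
      ENNReal.ofReal (2 * √(b * c)) := by
  have h1 : ∫⁻ t in Set.Ioc 0 b, ENNReal.ofReal (|t| / c) ^ (-(1 / 2) : ℝ) =
      ∫⁻ t in Set.Ioc 0 b, ENNReal.ofReal (√c * t ^ (-(1 / 2) : ℝ)) := by
    refine setLIntegral_congr_fun measurableSet_Ioc fun t ht => ?_
    rw [abs_of_pos ht.1, ENNReal.ofReal_rpow_of_pos (div_pos ht.1 hc),
      Real.div_rpow ht.1.le hc.le, Real.rpow_neg hc.le, div_inv_eq_mul, Real.sqrt_eq_rpow,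
      mul_comm]
  have hi : IntervalIntegrable (fun t : ℝ => t ^ (-(1 / 2) : ℝ)) volume 0 b :=
    intervalIntegral.intervalIntegrable_rpow' (by norm_num)
  rw [h1, ← ofReal_integral_eq_lintegral_ofReal, ← intervalIntegral.integral_of_le hb.le,
    intervalIntegral.integral_const_mul, integral_rpow (Or.inl (by norm_num)),
    Real.sqrt_mul hb.le, Real.sqrt_eq_rpow b]
  · congr 1
    norm_num
    ring
  · exact (hi.1).const_mul _
  · filter_upwards [self_mem_ae_restrict measurableSet_Ioc] with t ht
    exact mul_nonneg (Real.sqrt_nonneg _) (Real.rpow_nonneg ht.1.le _)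

lemma setLIntegral_rpow_neg_half_Icc_le {b c : ℝ} (hb : 0 < b) (hc : 0 < c) :
    ∫⁻ t in Set.Icc (-b) b, ENNReal.ofReal (|t| / c) ^ (-(1 / 2) : ℝ) ≤
      ENNReal.ofReal (4 * √(b * c)) := by
  set g : ℝ → ENNReal := fun t => ENNReal.ofReal (|t| / c) ^ (-(1 / 2) : ℝ) with hg
  have hgm : Measurable g := by fun_prop
  have hsub : Set.Icc (-b) b ⊆ Set.Icc (-b) 0 ∪ Set.Ioc 0 b := by
    intro t ht
    rcases le_or_gt t 0 with h | h
    · exact Or.inl ⟨ht.1, h⟩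
    · exact Or.inr ⟨h, ht.2⟩
  have hneg : ∫⁻ t in Set.Icc (-b) 0, g t = ∫⁻ t in Set.Ioc 0 b, g t := by
    have h := (Measure.measurePreserving_neg (volume : Measure ℝ)).setLIntegral_comp_preimage
      (s := Set.Icc (-b) 0) measurableSet_Icc hgm
    have e : (Neg.neg : ℝ → ℝ) ⁻¹' Set.Icc (-b) 0 = Set.Icc 0 b := by
      ext x
      simp only [Set.mem_preimage, Set.mem_Icc]
      constructor <;> rintro ⟨h1, h2⟩ <;> constructor <;> linarith
    rw [← h, e, setLIntegral_congr Ioc_ae_eq_Icc.symm]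
    simp [hg]
  calc ∫⁻ t in Set.Icc (-b) b, g t ≤ ∫⁻ t in Set.Icc (-b) 0 ∪ Set.Ioc 0 b, g t :=
        lintegral_mono_set hsub
    _ ≤ (∫⁻ t in Set.Icc (-b) 0, g t) + ∫⁻ t in Set.Ioc 0 b, g t := lintegral_union_le _ _ _
    _ = ENNReal.ofReal (4 * √(b * c)) := by
        rw [hneg, setLIntegral_rpow_neg_half_Ioc hb hc, ← ENNReal.ofReal_add (by positivity)
          (by positivity)]
        ring_nf

/-- If `ρ ≥ 1/2` nothing is to be proved, since `x ≤ 3δ`. If `ρ < 1/2`, then `m = |1 - zζ̄|`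
satisfies `m² ≤ m²/4 + 4δm`, so `m ≤ 6δ` and `ρ` is comparable to the Euclidean distance divided by
`δ`. -/
lemma pseudoDist_ge_of_norm_sub_ge {z ζ : ℂ} {δ x : ℝ} (hz : ‖z‖ = 1 - δ) (hδ : 0 < δ)
    (hζ : ‖ζ‖ ≤ 1) (hx0 : 0 ≤ x) (hx : x ≤ 3 * δ) (h : x ≤ ‖z - ζ‖) :
    x / (6 * δ) ≤ pseudoDist z ζ := by
  have hz1 : ‖z‖ < 1 := by linarith
  by_contra! hcon
  have hlt : pseudoDist z ζ < 1 / 2 := by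
    refine hcon.trans_le ?_
    rw [div_le_iff₀ (by linarith)]
    linarith
  have hpos := norm_one_sub_mul_conj_pos hz1 hζ
  have h1 := normSq_one_sub_mul_conj z ζ
  set m := ‖1 - z * (starRingEnd ℂ) ζ‖
  have h2 : ‖z - ζ‖ < 1 / 2 * m := by
    unfold pseudoDist at hlt
    rwa [div_lt_iff₀ hpos] at hlt
  have h3 : 1 - ‖ζ‖ ≤ m := one_sub_le_norm_one_sub_mul_conj' hz1.le
  have h4 : 1 - ‖ζ‖ ^ 2 ≤ 2 * m := by nlinarith [norm_nonneg ζ]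
  have h5 : 1 - ‖z‖ ^ 2 ≤ 2 * δ := by rw [hz]; nlinarith
  have h6 : (1 - ‖z‖ ^ 2) * (1 - ‖ζ‖ ^ 2) ≤ 2 * δ * (2 * m) :=
    mul_le_mul h5 h4 (by nlinarith [norm_nonneg ζ]) (by linarith)
  have h7 : ‖z - ζ‖ ^ 2 ≤ 1 / 4 * m ^ 2 := by nlinarith [norm_nonneg (z - ζ)]
  have h8 : m ≤ 6 * δ := by nlinarith
  have : x / (6 * δ) ≤ pseudoDist z ζ := div_le_div₀ (norm_nonneg _) h hpos h8
  linarith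

lemma setLIntegral_pseudoDist_rpow_le {r a : ℝ} (hr : 1 / 2 ≤ r) (hr1 : r < 1) {ζ : ℂ}
    (hζ : ‖ζ‖ ≤ 1) :
    ∫⁻ s in Set.Icc (-(1 - r)) (1 - r),
      ENNReal.ofReal (pseudoDist (polarPt r (a - s)) ζ) ^ (-(1 / 2) : ℝ) ≤
      ENNReal.ofReal (36 * (1 - r)) := by
  set δ := 1 - r with hδ
  have hδ0 : 0 < δ := by linarith
  -- The parameter of a point of the arc nearest to `ζ`: every other point of the arc is at least
  -- half as far from `ζ` as from this one, so `ρ` is bounded below by a multiple of `|s - s₀|/δ`,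
  -- uniformly in `ζ`.
  obtain ⟨s₀, hs₀, hmin⟩ := (isCompact_Icc (a := -δ) (b := δ)).exists_isMinOn
    (Set.nonempty_Icc.mpr (by linarith)) (f := fun s => ‖polarPt r (a - s) - ζ‖)
    (by have := continuous_polarPt r; fun_prop)
  have hpi := Real.pi_gt_three
  have hpi4 := Real.pi_lt_d2
  have key : ∀ s ∈ Set.Icc (-δ) δ,
      |s - s₀| / (40 * δ) ≤ pseudoDist (polarPt r (a - s)) ζ := by
    intro s hs
    have hab : |s - s₀| ≤ 2 * δ :=
      abs_le.mpr ⟨by linarith [hs.1, hs₀.2], by linarith [hs.2, hs₀.1]⟩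
    have h1 : ‖polarPt r (a - s) - polarPt r (a - s₀)‖ ≤ 2 * ‖polarPt r (a - s) - ζ‖ := by
      have h2 : ‖polarPt r (a - s₀) - ζ‖ ≤ ‖polarPt r (a - s) - ζ‖ := hmin hs
      have h3 := norm_sub_le_norm_sub_add_norm_sub (polarPt r (a - s)) ζ (polarPt r (a - s₀))
      rw [norm_sub_rev ζ] at h3
      linarith
    have h2 : ‖polarPt r (a - s) - polarPt r (a - s₀)‖ =
        r * ‖1 - Complex.exp ((s - s₀ : ℝ) * Complex.I)‖ := by
      rw [← norm_polarPt_sub (by linarith)]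
      congr 3
      ring
    have h3 := two_div_pi_mul_abs_le (x := s - s₀) (by linarith)
    have h4 : |s - s₀| * (3 / 20) ≤ ‖polarPt r (a - s) - ζ‖ := by
      have h5 : 3 / 5 ≤ 2 / Real.pi := by
        rw [div_le_div_iff₀ (by norm_num) (by linarith)]; linarith
      have h6 : 3 / 5 * |s - s₀| ≤ ‖1 - Complex.exp ((s - s₀ : ℝ) * Complex.I)‖ :=
        (mul_le_mul_of_nonneg_right h5 (abs_nonneg _)).trans h3
      have h7 := mul_le_mul hr h6 (by positivity) (by linarith)
      rw [← h2] at h7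
      linarith
    -- The constant `40` of `key` is `6 / (3/20)`; here `3/20` is half of `r ≥ 1/2` times `3/5 ≤
    -- 2/π`.
    have h5 := pseudoDist_ge_of_norm_sub_ge (z := polarPt r (a - s)) (δ := δ)
      (by rw [norm_polarPt (by linarith)]; linarith) hδ0 hζ (by positivity)
      (by linarith [abs_nonneg (s - s₀)]) h4
    refine le_trans (le_of_eq ?_) h5
    field_simp
    ring
  have hgm : Measurable fun t : ℝ => ENNReal.ofReal (|t| / (40 * δ)) ^ (-(1 / 2) : ℝ) := by
    fun_prop
  calc ∫⁻ s in Set.Icc (-δ) δ, ENNReal.ofReal (pseudoDist (polarPt r (a - s)) ζ) ^ (-(1 / 2) : ℝ)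
      ≤ ∫⁻ s in Set.Icc (-δ) δ, ENNReal.ofReal (|s - s₀| / (40 * δ)) ^ (-(1 / 2) : ℝ) :=
        setLIntegral_mono' measurableSet_Icc fun s hs =>
          by
            rw [ENNReal.rpow_neg, ENNReal.rpow_neg, ENNReal.inv_le_inv]
            exact ENNReal.rpow_le_rpow (ENNReal.ofReal_le_ofReal (key s hs)) (by norm_num)
    _ ≤ ∫⁻ s in (fun s => s - s₀) ⁻¹' Set.Icc (-(2 * δ)) (2 * δ),
          ENNReal.ofReal (|s - s₀| / (40 * δ)) ^ (-(1 / 2) : ℝ) := by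
        refine lintegral_mono_set fun s hs => ⟨?_, ?_⟩ <;> simp only <;>
          linarith [hs.1, hs.2, hs₀.1, hs₀.2]
    _ = ∫⁻ t in Set.Icc (-(2 * δ)) (2 * δ), ENNReal.ofReal (|t| / (40 * δ)) ^ (-(1 / 2) : ℝ) :=
        (measurePreserving_sub_right (volume : Measure ℝ) s₀).setLIntegral_comp_preimage
          measurableSet_Icc hgm
    _ ≤ ENNReal.ofReal (4 * √(2 * δ * (40 * δ))) :=
        setLIntegral_rpow_neg_half_Icc_le (by linarith) (by linarith)
    _ ≤ ENNReal.ofReal (36 * δ) := by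
        refine ENNReal.ofReal_le_ofReal ?_
        have : √(2 * δ * (40 * δ)) ≤ 9 * δ := by
          rw [Real.sqrt_le_left (by linarith)]; nlinarith
        linarith

/-! ### Removing the singularity from the integral means. -/

/-- The integral of `boxKernel z` against `Λ`. -/
noncomputable def kernelIntegral (Λ : Measure ℂ) (z : ℂ) : ENNReal :=
  ∫⁻ ζ, ENNReal.ofReal (boxKernel z ζ) ∂Λ

/-- The integral of `boxKernel z ζ * pseudoDist z ζ ^ (-ε)` against `Λ`. -/
noncomputable def singularIntegral (ε : ℝ) (Λ : Measure ℂ) (z : ℂ) : ENNReal :=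
  ∫⁻ ζ, ENNReal.ofReal (boxKernel z ζ) * ENNReal.ofReal (pseudoDist z ζ) ^ (-ε) ∂Λ

lemma measurable_boxKernel_polarPt (r : ℝ) :
    Measurable fun q : ℝ × ℂ => ENNReal.ofReal (boxKernel (polarPt r q.1) q.2) :=
  (measurable_boxKernel.comp
    (((continuous_polarPt r).measurable.comp measurable_fst).prodMk measurable_snd)).ennreal_ofReal

lemma measurable_pseudoDist_polarPt (r : ℝ) :
    Measurable fun q : ℝ × ℂ => ENNReal.ofReal (pseudoDist (polarPt r q.1) q.2) :=
  (measurable_pseudoDist.comp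
    (((continuous_polarPt r).measurable.comp measurable_fst).prodMk measurable_snd)).ennreal_ofReal

/-- Harnack's inequality: the rotation moves the point by at most `1 - r ≤ |1 - zζ̄|`, so the
denominator at most doubles before squaring. -/
lemma boxKernel_polarPt_le {r φ s : ℝ} (hr0 : 0 ≤ r) (hr1 : r < 1) (hs : |s| ≤ 1 - r) {ζ : ℂ}
    (hζ : ‖ζ‖ ≤ 1) :
    boxKernel (polarPt r φ) ζ ≤ 4 * boxKernel (polarPt r (φ + s)) ζ := by
  have hn := norm_polarPt hr0 φ
  have hn' := norm_polarPt hr0 (φ + s)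
  have hpos := norm_one_sub_mul_conj_pos (z := polarPt r φ) (by rw [hn]; exact hr1) hζ
  have hpos' := norm_one_sub_mul_conj_pos (z := polarPt r (φ + s)) (by rw [hn']; exact hr1) hζ
  have h1 := one_sub_le_norm_one_sub_mul_conj (z := polarPt r φ) hζ
  rw [hn] at h1
  have h2 : ‖polarPt r φ - polarPt r (φ + s)‖ ≤ 1 - r := by
    rw [norm_polarPt_sub hr0]
    have := (norm_one_sub_exp_le s).trans hs
    nlinarith [norm_nonneg (1 - Complex.exp (s * Complex.I))]
  have h3 : ‖1 - polarPt r (φ + s) * (starRingEnd ℂ) ζ‖ ≤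
      2 * ‖1 - polarPt r φ * (starRingEnd ℂ) ζ‖ := by
    have e : 1 - polarPt r (φ + s) * (starRingEnd ℂ) ζ =
        (1 - polarPt r φ * (starRingEnd ℂ) ζ) +
          (polarPt r φ - polarPt r (φ + s)) * (starRingEnd ℂ) ζ := by ring
    rw [e]
    refine (norm_add_le _ _).trans ?_
    rw [norm_mul, RCLike.norm_conj]
    have := mul_le_mul h2 hζ (norm_nonneg _) (by linarith)
    linarith
  unfold boxKernel
  rw [hn, hn', ← mul_div_assoc, div_le_div_iff₀ (by positivity) (by positivity)]
  have h4 := pow_le_pow_left₀ hpos'.le h3 2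
  have h5 : 0 ≤ 1 - r ^ 2 := by nlinarith
  nlinarith [mul_le_mul_of_nonneg_left h4 h5]

section Upper

variable {Λ : Measure ℂ}

lemma measurable_kernelIntegral_polarPt [IsFiniteMeasure Λ] (r : ℝ) :
    Measurable fun φ => kernelIntegral Λ (polarPt r φ) :=
  (measurable_boxKernel_polarPt r).lintegral_prod_right'

lemma ae_norm_le_one (hΛ : Λ (Metric.closedBall 0 1)ᶜ = 0) : ∀ᵐ ζ ∂Λ, ‖ζ‖ ≤ 1 := by
  have : ∀ᵐ ζ ∂Λ, ζ ∈ Metric.closedBall (0 : ℂ) 1 := by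
    rwa [ae_iff]
  simpa using this

lemma kernelIntegral_polarPt_le (hΛ : Λ (Metric.closedBall 0 1)ᶜ = 0) {r φ s : ℝ} (hr0 : 0 ≤ r)
    (hr1 : r < 1) (hs : |s| ≤ 1 - r) :
    kernelIntegral Λ (polarPt r φ) ≤ 4 * kernelIntegral Λ (polarPt r (φ + s)) := by
  unfold kernelIntegral
  rw [← lintegral_const_mul' _ _ (by norm_num)]
  refine lintegral_mono_ae ?_
  filter_upwards [ae_norm_le_one hΛ] with ζ hζ
  calc ENNReal.ofReal (boxKernel (polarPt r φ) ζ)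
      ≤ ENNReal.ofReal (4 * boxKernel (polarPt r (φ + s)) ζ) :=
        ENNReal.ofReal_le_ofReal (boxKernel_polarPt_le hr0 hr1 hs hζ)
    _ = 4 * ENNReal.ofReal (boxKernel (polarPt r (φ + s)) ζ) := by
        rw [ENNReal.ofReal_mul (by norm_num)]; norm_num

/-- The singular factor costs only a constant in the `p`-th mean. After Hölder and Fubini it is
enough to fix `ζ` and to average `ρ^(-1/2)` against `N^(p-1) K(·,ζ)`, which is almost constant over
arcs of length comparable to `1 - r`. -/
lemma setLIntegral_singularIntegral_rpow_le [IsFiniteMeasure Λ]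
    (hΛ : Λ (Metric.closedBall 0 1)ᶜ = 0) {p : ℝ}
    (hp : 1 < p) {r : ℝ} (hr : 1 / 2 ≤ r) (hr1 : r < 1) :
    ∫⁻ φ in Set.Ioc 0 (2 * Real.pi), singularIntegral (1 / (2 * p)) Λ (polarPt r φ) ^ p ≤
      4 ^ p * 18 * ∫⁻ φ in Set.Ioc 0 (2 * Real.pi), kernelIntegral Λ (polarPt r φ) ^ p := by
  set I := Set.Ioc 0 (2 * Real.pi)
  have hp0 : 0 < p := by linarith
  set k : ℝ → ℂ → ENNReal := fun φ ζ => ENNReal.ofReal (boxKernel (polarPt r φ) ζ) with hk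
  set ρ : ℝ → ℂ → ENNReal := fun φ ζ => ENNReal.ofReal (pseudoDist (polarPt r φ) ζ) with hρ
  set N : ℝ → ENNReal := fun φ => kernelIntegral Λ (polarPt r φ) with hN
  have hkm : Measurable (Function.uncurry k) := measurable_boxKernel_polarPt r
  have hρm : Measurable (Function.uncurry ρ) := measurable_pseudoDist_polarPt r
  have hNm : Measurable N := measurable_kernelIntegral_polarPt (Λ := Λ) r
  have hk1 : ∀ φ, Measurable (k φ) := fun φ => hkm.of_uncurry_left
  have hρ1 : ∀ φ, Measurable (ρ φ) := fun φ => hρm.of_uncurry_left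
  have hk2 : ∀ ζ, Measurable fun φ => k φ ζ := fun ζ => hkm.of_uncurry_right
  have hρ2 : ∀ ζ, Measurable fun φ => ρ φ ζ := fun ζ => hρm.of_uncurry_right
  have hNp : Measurable fun φ => N φ ^ (p - 1) := hNm.pow_const _
  have hδ0 : 0 < 1 - r := by linarith
  have step1 : ∀ φ, singularIntegral (1 / (2 * p)) Λ (polarPt r φ) ^ p ≤
      ∫⁻ ζ, N φ ^ (p - 1) * k φ ζ * ρ φ ζ ^ (-(1 / 2) : ℝ) ∂Λ := by
    intro φ
    have h := lintegral_mul_rpow_le Λ hp (hk1 φ) ((hρ1 φ).pow_const (-(1 / (2 * p))))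
    -- The exponent `1/(2p)` is chosen so that its `p`-th multiple is `1/2 < 1`, hence integrable
    -- along an arc.
    have e : ∀ ζ, (ρ φ ζ ^ (-(1 / (2 * p)))) ^ p = ρ φ ζ ^ (-(1 / 2) : ℝ) := by
      intro ζ
      rw [← ENNReal.rpow_mul]
      congr 1
      field_simp
    simp only [e] at h
    calc singularIntegral (1 / (2 * p)) Λ (polarPt r φ) ^ p
        ≤ N φ ^ (p - 1) * ∫⁻ ζ, k φ ζ * ρ φ ζ ^ (-(1 / 2) : ℝ) ∂Λ := h
      _ = _ := by
          have hm : Measurable fun ζ => k φ ζ * ρ φ ζ ^ (-(1 / 2) : ℝ) :=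
            (hk1 φ).mul ((hρ1 φ).pow_const _)
          rw [← lintegral_const_mul _ hm]
          simp only [mul_assoc]
  have step2 : ∀ᵐ ζ ∂Λ, ∫⁻ φ in I, N φ ^ (p - 1) * k φ ζ * ρ φ ζ ^ (-(1 / 2) : ℝ) ≤
      4 ^ p * 18 * ∫⁻ φ in I, N φ ^ (p - 1) * k φ ζ := by
    filter_upwards [ae_norm_le_one hΛ] with ζ hζ
    have h := setLIntegral_mul_le_of_harnack (δ := 1 - r) (A := 4 ^ p)
      (D := ENNReal.ofReal (36 * (1 - r))) (F := fun φ => N φ ^ (p - 1) * k φ ζ)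
      (R := fun φ => ρ φ ζ ^ (-(1 / 2) : ℝ)) (hNp.mul (hk2 ζ)) ((hρ2 ζ).pow_const _)
      (fun φ => by simp only [hN, hk, polarPt_add_two_pi])
      (fun φ => by simp only [hρ, polarPt_add_two_pi])
      (fun φ s hs => ?_) (fun a => setLIntegral_pseudoDist_rpow_le hr hr1 hζ)
    -- Dividing the arc integral `36(1-r)` by the arc length `2(1-r)` leaves `18`.
    · have e : ENNReal.ofReal (36 * (1 - r)) = ENNReal.ofReal (2 * (1 - r)) * 18 := by
        rw [show (18 : ENNReal) = ENNReal.ofReal 18 by norm_num,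
          ← ENNReal.ofReal_mul (by linarith)]
        ring_nf
      rw [e, show ∀ x y z w : ENNReal, x * (y * z) * w = y * (x * z * w) by intros; ring] at h
      exact (ENNReal.mul_le_mul_iff_right (by simpa using hr1) ENNReal.ofReal_ne_top).mp h
    · have h1 := ENNReal.rpow_le_rpow
        (kernelIntegral_polarPt_le hΛ (r := r) (φ := φ) (by linarith) hr1 hs)
        (show 0 ≤ p - 1 by linarith)
      rw [ENNReal.mul_rpow_of_nonneg _ _ (by linarith)] at h1
      have h2 : k φ ζ ≤ 4 * k (φ + s) ζ := by
        have h3 := ENNReal.ofReal_le_ofReal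
          (boxKernel_polarPt_le (r := r) (φ := φ) (by linarith) hr1 hs hζ)
        rwa [ENNReal.ofReal_mul (by norm_num), ENNReal.ofReal_ofNat] at h3
      have e := ENNReal.rpow_add (x := 4) (p - 1) 1 (by norm_num) (by norm_num)
      rw [sub_add_cancel, ENNReal.rpow_one] at e
      calc N φ ^ (p - 1) * k φ ζ
          ≤ (4 ^ (p - 1) * N (φ + s) ^ (p - 1)) * (4 * k (φ + s) ζ) := mul_le_mul' h1 h2
        _ = 4 ^ p * (N (φ + s) ^ (p - 1) * k (φ + s) ζ) := by rw [e]; ring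
  have hm3 : Measurable fun q : ℝ × ℂ => N q.1 ^ (p - 1) * k q.1 q.2 :=
    (hNp.comp measurable_fst).mul hkm
  have hm4 : Measurable fun q : ℝ × ℂ => N q.1 ^ (p - 1) * k q.1 q.2 * ρ q.1 q.2 ^ (-(1 / 2) : ℝ) :=
    hm3.mul (hρm.pow_const _)
  calc ∫⁻ φ in I, singularIntegral (1 / (2 * p)) Λ (polarPt r φ) ^ p
      ≤ ∫⁻ φ in I, ∫⁻ ζ, N φ ^ (p - 1) * k φ ζ * ρ φ ζ ^ (-(1 / 2) : ℝ) ∂Λ :=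
        lintegral_mono step1
    _ = ∫⁻ ζ, (∫⁻ φ in I, N φ ^ (p - 1) * k φ ζ * ρ φ ζ ^ (-(1 / 2) : ℝ)) ∂Λ :=
        lintegral_lintegral_swap hm4.aemeasurable
    _ ≤ ∫⁻ ζ, 4 ^ p * 18 * (∫⁻ φ in I, N φ ^ (p - 1) * k φ ζ) ∂Λ := lintegral_mono_ae step2
    _ = 4 ^ p * 18 * ∫⁻ ζ, (∫⁻ φ in I, N φ ^ (p - 1) * k φ ζ) ∂Λ :=
        lintegral_const_mul' _ _ (ENNReal.mul_ne_top
          (ENNReal.rpow_ne_top_of_nonneg hp0.le (by norm_num)) (by norm_num))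
    _ = 4 ^ p * 18 * ∫⁻ φ in I, ∫⁻ ζ, N φ ^ (p - 1) * k φ ζ ∂Λ := by
        rw [← lintegral_lintegral_swap hm3.aemeasurable]
    _ = 4 ^ p * 18 * ∫⁻ φ in I, N φ ^ p := by
        congr 1
        refine lintegral_congr fun φ => ?_
        rw [lintegral_const_mul _ (hk1 φ)]
        change N φ ^ (p - 1) * N φ = N φ ^ p
        nth_rw 2 [← ENNReal.rpow_one (N φ)]
        rw [← ENNReal.rpow_add_of_nonneg _ _ (by linarith) zero_le_one, sub_add_cancel]

/-! ### Comparison of the kernel integral with Carleson boxes. -/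

/-- One term suffices: for the least `j` with `|1 - zζ̄| ≤ 2^j (1-r)` the point lies in the `j`-th
box and the kernel is at most `8 * 4^(-j)/(1-r)`. The factor `4^(-j)` is kept as two factors
`2^(-j)`: one becomes the weight in Hölder's inequality, the other offsets the growth of the boxes.
-/
lemma ofReal_boxKernel_polarPt_le_tsum {r φ : ℝ} (hr0 : 0 ≤ r) (hr1 : r < 1) {ζ : ℂ}
    (hζ : ‖ζ‖ ≤ 1) :
    ENNReal.ofReal (boxKernel (polarPt r φ) ζ) ≤ ENNReal.ofReal (8 / (1 - r)) *
      ∑' j : ℕ, (2⁻¹ : ENNReal) ^ j * ((2⁻¹ : ENNReal) ^ j *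
        (carlesonBox φ (2 * (2 ^ j * (1 - r)))).indicator 1 ζ) := by
  set δ := 1 - r with hδ
  have hδ0 : 0 < δ := by linarith
  have hn := norm_polarPt hr0 φ
  set m := ‖1 - polarPt r φ * (starRingEnd ℂ) ζ‖ with hm
  have hmδ : δ ≤ m := by
    have := one_sub_le_norm_one_sub_mul_conj (z := polarPt r φ) hζ
    rwa [hn] at this
  have hex : ∃ j : ℕ, m ≤ 2 ^ j * δ := by
    obtain ⟨j, hj⟩ := pow_unbounded_of_one_lt (m / δ) (one_lt_two)
    exact ⟨j, by rw [div_lt_iff₀ hδ0] at hj; exact hj.le⟩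
  classical
  set j := Nat.find hex
  have hj : m ≤ 2 ^ j * δ := Nat.find_spec hex
  have hj' : 2 ^ j * δ ≤ 2 * m := by
    rcases Nat.eq_zero_or_pos j with h | h
    · rw [h]; linarith
    · have := Nat.find_min hex (m := j - 1) (by omega)
      rw [not_le] at this
      have e : (2 : ℝ) ^ j = 2 * 2 ^ (j - 1) := by
        rw [← pow_succ']; congr 1; omega
      rw [e]; linarith
  have hmem : ζ ∈ carlesonBox φ (2 * (2 ^ j * δ)) := mem_carlesonBox_of_norm_le hr0 hr1.le hζ hj
  have hbk : boxKernel (polarPt r φ) ζ ≤ 8 / δ * ((2⁻¹) ^ j * (2⁻¹) ^ j) := by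
    unfold boxKernel
    rw [hn, ← hm, div_le_iff₀ (by nlinarith)]
    have e : 8 / δ * ((2⁻¹) ^ j * (2⁻¹) ^ j) * m ^ 2 =
        8 / δ * (m / 2 ^ j) ^ 2 := by
      rw [inv_pow]; field_simp
    rw [e]
    have h1 : δ / 2 ≤ m / 2 ^ j := by
      rw [div_le_div_iff₀ (by norm_num) (by positivity)]; linarith
    have h2 : (δ / 2) ^ 2 ≤ (m / 2 ^ j) ^ 2 := pow_le_pow_left₀ (by linarith) h1 2
    calc 1 - r ^ 2 ≤ 8 / δ * (δ / 2) ^ 2 := by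
          have : 8 / δ * (δ / 2) ^ 2 = 2 * δ := by field_simp; norm_num
          rw [this]; nlinarith
      _ ≤ _ := by gcongr
  calc ENNReal.ofReal (boxKernel (polarPt r φ) ζ)
      ≤ ENNReal.ofReal (8 / δ * ((2⁻¹) ^ j * (2⁻¹) ^ j)) := ENNReal.ofReal_le_ofReal hbk
    _ = ENNReal.ofReal (8 / δ) * ((2⁻¹ : ENNReal) ^ j * ((2⁻¹ : ENNReal) ^ j *
        (carlesonBox φ (2 * (2 ^ j * δ))).indicator 1 ζ)) := by
        rw [Set.indicator_of_mem hmem, Pi.one_apply, mul_one, ENNReal.ofReal_mul (by positivity),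
          ENNReal.ofReal_mul (by positivity), ENNReal.ofReal_pow (by norm_num),
          ENNReal.ofReal_inv_of_pos two_pos, ENNReal.ofReal_ofNat]
    _ ≤ _ := by
        gcongr
        exact ENNReal.le_tsum j

lemma kernelIntegral_polarPt_le_tsum (hΛ : Λ (Metric.closedBall 0 1)ᶜ = 0) {r φ : ℝ} (hr0 : 0 ≤ r)
    (hr1 : r < 1) :
    kernelIntegral Λ (polarPt r φ) ≤ ENNReal.ofReal (8 / (1 - r)) *
      ∑' j : ℕ, (2⁻¹ : ENNReal) ^ j * ((2⁻¹ : ENNReal) ^ j *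
        Λ (carlesonBox φ (2 * (2 ^ j * (1 - r))))) := by
  have hb : ∀ j : ℕ, Measurable ((carlesonBox φ (2 * (2 ^ j * (1 - r)))).indicator
      (1 : ℂ → ENNReal)) :=
    fun j => measurable_one.indicator (measurableSet_carlesonBox _ _)
  calc kernelIntegral Λ (polarPt r φ)
      ≤ ∫⁻ ζ, ENNReal.ofReal (8 / (1 - r)) *
        ∑' j : ℕ, (2⁻¹ : ENNReal) ^ j * ((2⁻¹ : ENNReal) ^ j *
          (carlesonBox φ (2 * (2 ^ j * (1 - r)))).indicator 1 ζ) ∂Λ := by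
        refine lintegral_mono_ae ?_
        filter_upwards [ae_norm_le_one hΛ] with ζ hζ
        exact ofReal_boxKernel_polarPt_le_tsum hr0 hr1 hζ
    _ = _ := by
        rw [lintegral_const_mul' _ _ ENNReal.ofReal_ne_top, lintegral_tsum]
        · congr 2
          ext j
          rw [lintegral_const_mul _ ((hb j).const_mul _), lintegral_const_mul _ (hb j),
            lintegral_indicator_one (measurableSet_carlesonBox _ _)]
        · exact fun j => (((hb j).const_mul _).const_mul _).aemeasurable

lemma tsum_inv_two_pow : ∑' j : ℕ, (2⁻¹ : ENNReal) ^ j = 2 := by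
  rw [ENNReal.tsum_geometric, ENNReal.one_sub_inv_two, inv_inv]

lemma setLIntegral_kernelIntegral_rpow_le [IsFiniteMeasure Λ]
    (hΛ : Λ (Metric.closedBall 0 1)ᶜ = 0) {p q : ℝ}
    (hp : 1 < p) (hq : 0 ≤ q) (hqp : q ≤ p) {B : ENNReal}
    (hB : ∀ δ : ℝ, 0 < δ → ∫⁻ φ in Set.Ioc 0 (2 * Real.pi), Λ (carlesonBox φ δ) ^ p ≤
      B * ENNReal.ofReal δ ^ q) {r : ℝ} (hr0 : 0 ≤ r) (hr1 : r < 1) :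
    ∫⁻ φ in Set.Ioc 0 (2 * Real.pi), kernelIntegral Λ (polarPt r φ) ^ p ≤
      ENNReal.ofReal (8 / (1 - r)) ^ p *
        (2 ^ (p - 1) * (2 * (B * (2 ^ q * ENNReal.ofReal (1 - r) ^ q)))) := by
  set I := Set.Ioc 0 (2 * Real.pi)
  have hp0 : 0 ≤ p := by linarith
  set δ := 1 - r
  have hδ0 : 0 < δ := by linarith
  set a : ℕ → ℝ → ENNReal := fun j φ => Λ (carlesonBox φ (2 * (2 ^ j * δ)))
  have ham : ∀ j, Measurable (a j) := fun j => measurable_measure_carlesonBox Λ _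
  have step1 : ∀ φ, kernelIntegral Λ (polarPt r φ) ^ p ≤
      ENNReal.ofReal (8 / δ) ^ p * (2 ^ (p - 1) *
        ∑' j : ℕ, (2⁻¹ : ENNReal) ^ j * ((2⁻¹ : ENNReal) ^ j * a j φ) ^ p) := by
    intro φ
    refine (ENNReal.rpow_le_rpow (kernelIntegral_polarPt_le_tsum hΛ hr0 hr1) hp0).trans ?_
    rw [ENNReal.mul_rpow_of_nonneg _ _ hp0]
    gcongr
    have h := lintegral_mul_rpow_le (Measure.count : Measure ℕ) hp
      (k := fun j => (2⁻¹ : ENNReal) ^ j) (g := fun j => (2⁻¹ : ENNReal) ^ j * a j φ)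
      (measurable_of_countable _) (measurable_of_countable _)
    simpa only [lintegral_count, tsum_inv_two_pow] using h
  have step2 : ∀ j : ℕ, ∫⁻ φ in I, ((2⁻¹ : ENNReal) ^ j * a j φ) ^ p ≤
      B * (2 ^ q * ENNReal.ofReal δ ^ q) := by
    intro j
    simp only [ENNReal.mul_rpow_of_nonneg _ _ hp0]
    rw [lintegral_const_mul _ ((ham j).pow_const _)]
    have h1 := hB (2 * (2 ^ j * δ)) (by positivity)
    have e : ENNReal.ofReal (2 * (2 ^ j * δ)) ^ q =
        2 ^ q * ((2 ^ j : ENNReal) ^ q * ENNReal.ofReal δ ^ q) := by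
      rw [ENNReal.ofReal_mul (by norm_num), ENNReal.ofReal_mul (by positivity),
        ENNReal.ofReal_pow (by norm_num), ENNReal.ofReal_ofNat,
        ENNReal.mul_rpow_of_nonneg _ _ hq, ENNReal.mul_rpow_of_nonneg _ _ hq]
    rw [e] at h1
    -- Here `q ≤ p`, that is `γ ≤ 1`, enters: the spare factor `2^(-j)` beats the growth `2^(jq/p)`
    -- of the box means.
    have h2 : ((2⁻¹ : ENNReal) ^ j) ^ p * (2 ^ j : ENNReal) ^ q ≤ 1 := by
      calc ((2⁻¹ : ENNReal) ^ j) ^ p * (2 ^ j : ENNReal) ^ q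
          ≤ ((2⁻¹ : ENNReal) ^ j) ^ p * (2 ^ j : ENNReal) ^ p := by
            gcongr
            exact one_le_pow₀ (by norm_num)
        _ = 1 := by
            rw [← ENNReal.mul_rpow_of_nonneg _ _ hp0, ← mul_pow,
              ENNReal.inv_mul_cancel (by norm_num) (by norm_num), one_pow, ENNReal.one_rpow]
    calc ((2⁻¹ : ENNReal) ^ j) ^ p * ∫⁻ φ in I, a j φ ^ p
        ≤ ((2⁻¹ : ENNReal) ^ j) ^ p * (B * (2 ^ q * ((2 ^ j : ENNReal) ^ q *
            ENNReal.ofReal δ ^ q))) := by gcongr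
      _ = (((2⁻¹ : ENNReal) ^ j) ^ p * (2 ^ j : ENNReal) ^ q) *
            (B * (2 ^ q * ENNReal.ofReal δ ^ q)) := by ring
      _ ≤ 1 * (B * (2 ^ q * ENNReal.ofReal δ ^ q)) := by gcongr
      _ = _ := one_mul _
  have hmt : ∀ j : ℕ, Measurable fun φ => ((2⁻¹ : ENNReal) ^ j * a j φ) ^ p :=
    fun j => ((ham j).const_mul _).pow_const _
  calc ∫⁻ φ in I, kernelIntegral Λ (polarPt r φ) ^ p
      ≤ ∫⁻ φ in I, ENNReal.ofReal (8 / δ) ^ p * (2 ^ (p - 1) *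
        ∑' j : ℕ, (2⁻¹ : ENNReal) ^ j * ((2⁻¹ : ENNReal) ^ j * a j φ) ^ p) :=
        lintegral_mono step1
    _ = ENNReal.ofReal (8 / δ) ^ p * (2 ^ (p - 1) *
        ∑' j : ℕ, (2⁻¹ : ENNReal) ^ j * ∫⁻ φ in I, ((2⁻¹ : ENNReal) ^ j * a j φ) ^ p) := by
        rw [lintegral_const_mul' _ _ (ENNReal.rpow_ne_top_of_nonneg hp0 ENNReal.ofReal_ne_top),
          lintegral_const_mul' _ _ (ENNReal.rpow_ne_top_of_nonneg (by linarith) (by norm_num)),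
          lintegral_tsum fun j => ((hmt j).const_mul _).aemeasurable]
        congr 3
        ext j
        rw [lintegral_const_mul _ (hmt j)]
    _ ≤ ENNReal.ofReal (8 / δ) ^ p * (2 ^ (p - 1) *
        ∑' j : ℕ, (2⁻¹ : ENNReal) ^ j * (B * (2 ^ q * ENNReal.ofReal δ ^ q))) := by
        gcongr with j
        exact step2 j
    _ = _ := by rw [ENNReal.tsum_mul_right, tsum_inv_two_pow]

/-- If the box means of `Λ` are `O(δ ^ (q / p))`, then the means of the singular integral are
`O((1 - r) ^ (q / p - 1))`. -/
theorem setLIntegral_singularIntegral_le_of_box [IsFiniteMeasure Λ]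
    (hΛ : Λ (Metric.closedBall 0 1)ᶜ = 0) {p q : ℝ}
    (hp : 1 < p) (hq : 0 ≤ q) (hqp : q ≤ p) {B : ENNReal} (hBtop : B ≠ ⊤)
    (hB : ∀ δ : ℝ, 0 < δ → ∫⁻ φ in Set.Ioc 0 (2 * Real.pi), Λ (carlesonBox φ δ) ^ p ≤
      B * ENNReal.ofReal δ ^ q) :
    ∃ A : ENNReal, A ≠ ⊤ ∧ ∀ r : ℝ, 1 / 2 ≤ r → r < 1 →
      ∫⁻ φ in Set.Ioc 0 (2 * Real.pi), singularIntegral (1 / (2 * p)) Λ (polarPt r φ) ^ p ≤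
        A * ENNReal.ofReal (1 - r) ^ (q - p) := by
  have hp0 : 0 ≤ p := by linarith
  refine ⟨4 ^ p * 18 * (8 ^ p * (2 ^ (p - 1) * (2 * (B * 2 ^ q)))), ?_, fun r hr hr1 => ?_⟩
  · have h4 : (4 : ENNReal) ^ p ≠ ⊤ := ENNReal.rpow_ne_top_of_nonneg hp0 (by norm_num)
    have h8 : (8 : ENNReal) ^ p ≠ ⊤ := ENNReal.rpow_ne_top_of_nonneg hp0 (by norm_num)
    have h2 : (2 : ENNReal) ^ (p - 1) ≠ ⊤ :=
      ENNReal.rpow_ne_top_of_nonneg (by linarith) (by norm_num)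
    have h2' : (2 : ENNReal) ^ q ≠ ⊤ := ENNReal.rpow_ne_top_of_nonneg hq (by norm_num)
    finiteness
  · refine (setLIntegral_singularIntegral_rpow_le hΛ hp hr hr1).trans ?_
    refine (mul_le_mul_right (setLIntegral_kernelIntegral_rpow_le hΛ hp hq hqp hB
      (by linarith) hr1) _).trans (le_of_eq ?_)
    have hδ : ENNReal.ofReal (1 - r) ≠ 0 := by simpa using hr1
    rw [ENNReal.ofReal_div_of_pos (by linarith), ENNReal.div_rpow_of_nonneg _ _ hp0,
      ENNReal.rpow_sub _ _ hδ ENNReal.ofReal_ne_top, ENNReal.ofReal_ofNat, div_eq_mul_inv,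
      div_eq_mul_inv]
    ring

/-- On the box `|1 - zζ̄| ≤ 6δ` and `1 - |z|² ≥ δ`, so the kernel is at least `1/(36δ)`. -/
lemma measure_carlesonBox_le_kernelIntegral {φ δ : ℝ} (hδ0 : 0 < δ) (hδ : δ < 1)
    (hΛ : Λ (Metric.closedBall 0 1)ᶜ = 0) :
    Λ (carlesonBox φ δ) ≤
      ENNReal.ofReal (36 * δ) * kernelIntegral Λ (polarPt (1 - δ) φ) := by
  have hn := norm_polarPt (r := 1 - δ) (by linarith) φ
  have hone : ENNReal.ofReal (36 * δ) * ENNReal.ofReal (1 / (36 * δ)) = 1 := by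
    rw [← ENNReal.ofReal_mul (by positivity), mul_one_div_cancel (by positivity),
      ENNReal.ofReal_one]
  calc Λ (carlesonBox φ δ)
      = ENNReal.ofReal (36 * δ) * (ENNReal.ofReal (1 / (36 * δ)) * Λ (carlesonBox φ δ)) := by
        rw [← mul_assoc, hone, one_mul]
    _ ≤ _ := by
        gcongr
        rw [← setLIntegral_const]
        refine le_trans (lintegral_mono_ae ?_) (setLIntegral_le_lintegral (carlesonBox φ δ) _)
        filter_upwards [ae_restrict_mem (measurableSet_carlesonBox φ δ),
          ae_restrict_of_ae (ae_norm_le_one hΛ)] with ζ hmem hζ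
        refine ENNReal.ofReal_le_ofReal ?_
        have h1 := norm_one_sub_mul_conj_le_of_mem_carlesonBox hδ0.le hδ.le hmem
        have hpos := norm_one_sub_mul_conj_pos (z := polarPt (1 - δ) φ) (by rw [hn]; linarith) hζ
        unfold boxKernel
        rw [hn, div_le_div_iff₀ (by positivity) (by positivity)]
        have h2 := pow_le_pow_left₀ hpos.le h1 2
        nlinarith

end Upper

/-! ### The zero measure, the complete measure and the potential of `log |f|`. -/

lemma lintegral_zeroMeasure (f : ℂ → ℂ) (F : ℂ → ENNReal) :
    ∫⁻ ζ, F ζ ∂(zeroMeasure f) = ∑' a : discZeros f, (analyticOrderNatAt f (a : ℂ)) * F a := by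
  rw [zeroMeasure, lintegral_sum_measure]
  congr 1
  ext a
  rw [lintegral_smul_measure, lintegral_dirac, nsmul_eq_mul]

lemma ae_zeroMeasure {f : ℂ → ℂ} {P : ℂ → Prop} (hP : MeasurableSet {ζ | P ζ})
    (h : ∀ a ∈ discZeros f, P a) : ∀ᵐ ζ ∂(zeroMeasure f), P ζ := by
  rw [ae_iff, zeroMeasure, ← Set.compl_ofPred, Measure.sum_apply _ hP.compl, ENNReal.tsum_eq_zero]
  intro a
  rw [Measure.smul_apply, Measure.dirac_apply' _ hP.compl, Set.indicator_of_notMem, smul_zero]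
  exact fun hcon => hcon (h a a.2)

lemma ae_zeroMeasure_norm_lt (f : ℂ → ℂ) : ∀ᵐ ζ ∂(zeroMeasure f), ‖ζ‖ < 1 :=
  ae_zeroMeasure (measurableSet_lt measurable_norm measurable_const) fun a ha => by
    simpa using ha.1

lemma exists_ae_zeroMeasure_le_norm_sub {f : ℂ → ℂ}
    (hf : DifferentiableOn ℂ f (Metric.ball (0 : ℂ) 1)) {z : ℂ} (hz : z ∈ Metric.ball (0 : ℂ) 1)
    (hfz : f z ≠ 0) : ∃ η > 0, η ≤ 1 ∧ ∀ᵐ ζ ∂(zeroMeasure f), η ≤ ‖z - ζ‖ := by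
  have hc : ContinuousAt f z := (hf.differentiableAt (Metric.isOpen_ball.mem_nhds hz)).continuousAt
  obtain ⟨η, hη, hη2⟩ := Metric.eventually_nhds_iff.mp (hc.eventually_ne hfz)
  refine ⟨min η 1, by positivity, min_le_right _ _, ae_zeroMeasure
    (measurableSet_le measurable_const (by fun_prop)) fun a ha => ?_⟩
  by_contra! hcon
  refine hη2 (y := a) ?_ ha.2
  rw [dist_comm, dist_eq_norm]
  exact hcon.trans_le (min_le_left _ _)

lemma neg_log_pseudoDist_nonneg {z ζ : ℂ} (hz : ‖z‖ < 1) (hζ : ‖ζ‖ ≤ 1) :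
    0 ≤ -Real.log (pseudoDist z ζ) :=
  neg_nonneg.mpr (Real.log_nonpos (pseudoDist_nonneg z ζ) (pseudoDist_le_one hz hζ))

lemma boxKernel_le {z ζ : ℂ} (hz : ‖z‖ < 1) (hζ : ‖ζ‖ ≤ 1) :
    boxKernel z ζ ≤ 1 / (1 - ‖z‖) ^ 2 := by
  have h := one_sub_le_norm_one_sub_mul_conj (z := z) hζ
  unfold boxKernel
  exact div_le_div₀ zero_le_one (by nlinarith [norm_nonneg z]) (by nlinarith)
    (pow_le_pow_left₀ (by linarith) h 2)

/-- Away from the pole the Green function is at most a constant times `1 - |ζ|`, so the Blaschke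
condition makes the potential finite where `f` does not vanish. The exponent `1/2` is merely a
convenient admissible `ε`. -/
lemma neg_log_pseudoDist_le_of_le_norm_sub {z ζ : ℂ} {η : ℝ} (hz : ‖z‖ < 1) (hζ : ‖ζ‖ ≤ 1)
    (hη : 0 < η) (h : η ≤ ‖z - ζ‖) :
    -Real.log (pseudoDist z ζ) ≤
      4 / (1 / 2) * (1 / (1 - ‖z‖) ^ 2) * (η / 2) ^ (-(1 / 2) : ℝ) * (1 - ‖ζ‖) := by
  have hne : z ≠ ζ := by
    rintro rfl
    rw [sub_self, norm_zero] at h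
    linarith
  have hρ : η / 2 ≤ pseudoDist z ζ :=
    div_le_div₀ (norm_nonneg _) h (norm_one_sub_mul_conj_pos hz hζ)
      (norm_one_sub_mul_conj_le_two hz.le hζ)
  have h2 : pseudoDist z ζ ^ (-(1 / 2) : ℝ) ≤ (η / 2) ^ (-(1 / 2) : ℝ) :=
    Real.rpow_le_rpow_of_nonpos (by positivity) hρ (by norm_num)
  refine (neg_log_pseudoDist_le (ε := 1 / 2) (by norm_num) le_rfl hz hζ hne).trans ?_
  have := boxKernel_nonneg hz.le ζ
  have := Real.rpow_nonneg (pseudoDist_nonneg z ζ) (-(1 / 2))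
  have := boxKernel_le hz hζ
  gcongr

lemma norm_sub_eq_of_norm_eq_one {z ζ : ℂ} (hζ : ‖ζ‖ = 1) :
    ‖z - ζ‖ = ‖1 - z * (starRingEnd ℂ) ζ‖ := by
  have h := normSq_one_sub_mul_conj z ζ
  rw [hζ] at h
  refine (sq_eq_sq₀ (norm_nonneg _) (norm_nonneg _)).mp ?_
  linarith

lemma pseudoDist_eq_one {z ζ : ℂ} (hz : ‖z‖ < 1) (hζ : ‖ζ‖ = 1) : pseudoDist z ζ = 1 := by
  rw [pseudoDist, norm_sub_eq_of_norm_eq_one hζ, div_self]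
  exact (norm_one_sub_mul_conj_pos hz hζ.le).ne'

lemma integral_log_pseudoDist (f : ℂ → ℂ) {z : ℂ} (hz : ‖z‖ < 1) :
    ∫ ζ, Real.log (‖z - ζ‖ / ‖1 - z * (starRingEnd ℂ) ζ‖) ∂(zeroMeasure f) =
      -(∫⁻ ζ, ENNReal.ofReal (-Real.log (pseudoDist z ζ)) ∂(zeroMeasure f)).toReal := by
  have hlm : Measurable fun ζ => -Real.log (pseudoDist z ζ) :=
    (Real.measurable_log.comp (measurable_pseudoDist.comp measurable_prodMk_left)).neg
  rw [← integral_eq_lintegral_of_nonneg_ae _ hlm.aestronglyMeasurable, integral_neg, neg_neg]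
  · rfl
  · filter_upwards [ae_zeroMeasure_norm_lt f] with ζ h1
    exact neg_log_pseudoDist_nonneg hz h1.le

/-- The complete measure assembled from the zeros of `f` and a boundary measure. -/
noncomputable def completeMeasure (f : ℂ → ℂ) (ψ : Measure ℂ) : Measure ℂ :=
  (zeroMeasure f).withDensity (fun ζ => ENNReal.ofReal (1 - ‖ζ‖)) + ψ

lemma lintegral_completeMeasure (f : ℂ → ℂ) (ψ : Measure ℂ) {F : ℂ → ENNReal} (hF : Measurable F) :
    ∫⁻ ζ, F ζ ∂(completeMeasure f ψ) =
      (∫⁻ ζ, ENNReal.ofReal (1 - ‖ζ‖) * F ζ ∂(zeroMeasure f)) + ∫⁻ ζ, F ζ ∂ψ := by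
  rw [completeMeasure, lintegral_add_measure,
    lintegral_withDensity_eq_lintegral_mul _ (by fun_prop) hF]
  rfl

section
variable {f : ℂ → ℂ} {ψ : Measure ℂ}

lemma IsBoundaryMeasure.isFiniteMeasure_completeMeasure (hψ : IsBoundaryMeasure f ψ) :
    IsFiniteMeasure (completeMeasure f ψ) := by
  have := hψ.finite
  refine ⟨?_⟩
  rw [completeMeasure, Measure.add_apply, withDensity_apply _ MeasurableSet.univ,
    Measure.restrict_univ]
  exact ENNReal.add_lt_top.mpr ⟨hψ.blaschke, measure_lt_top _ _⟩

lemma IsBoundaryMeasure.ae_norm_eq_one (hψ : IsBoundaryMeasure f ψ) : ∀ᵐ ζ ∂ψ, ‖ζ‖ = 1 := by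
  have : ∀ᵐ ζ ∂ψ, ζ ∈ Metric.sphere (0 : ℂ) 1 := by
    rw [ae_iff]; exact hψ.carried
  simpa using this

lemma IsBoundaryMeasure.completeMeasure_compl (hψ : IsBoundaryMeasure f ψ) :
    completeMeasure f ψ (Metric.closedBall 0 1)ᶜ = 0 := by
  have hm : MeasurableSet (Metric.closedBall (0 : ℂ) 1)ᶜ := Metric.isClosed_closedBall.measurableSet.compl
  rw [completeMeasure, Measure.add_apply, withDensity_apply _ hm, add_eq_zero]
  constructor
  · refine setLIntegral_measure_zero _ _ ?_
    have := ae_iff.mp (ae_zeroMeasure_norm_lt f)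
    refine measure_mono_null (fun ζ hζ => ?_) this
    simp only [Set.mem_compl_iff, mem_closedBall_zero_iff, not_le] at hζ
    simpa using hζ.le
  · refine measure_mono_null (Set.compl_subset_compl.mpr ?_) hψ.carried
    exact Metric.sphere_subset_closedBall

/-- The link between `f` and its complete measure. The factor `1 - |ζ|` in the two-sided bound for
`-log ρ` is exactly the density with which the zeros enter the complete measure, so the Green and
Poisson parts are estimated by the same kernel. -/
lemma IsBoundaryMeasure.exists_potential (hf : DifferentiableOn ℂ f (Metric.ball (0 : ℂ) 1))
    (hψ : IsBoundaryMeasure f ψ) {ε : ℝ} (hε : 0 < ε) (hε1 : ε ≤ 1 / 2) :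
    ∃ C : ℝ, ∀ z ∈ Metric.ball (0 : ℂ) 1, f z ≠ 0 → ∃ v : ENNReal, v ≠ ⊤ ∧
      Real.log ‖f z‖ = C - v.toReal ∧
      ENNReal.ofReal (1 / (2 * Real.pi)) * kernelIntegral (completeMeasure f ψ) z ≤ v ∧
      v ≤ ENNReal.ofReal (4 / ε) * singularIntegral ε (completeMeasure f ψ) z := by
  obtain ⟨C, hC⟩ := hψ.representation
  refine ⟨C, fun z hz hfz => ?_⟩
  have hfin := hψ.finite
  have hz1 : ‖z‖ < 1 := by simpa using hz
  obtain ⟨η, hη, -, hη1⟩ := exists_ae_zeroMeasure_le_norm_sub hf hz hfz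
  have hμ := ae_zeroMeasure_norm_lt f
  have hψ1 := hψ.ae_norm_eq_one
  have hkm : Measurable fun ζ => ENNReal.ofReal (boxKernel z ζ) :=
    (measurable_boxKernel.comp measurable_prodMk_left).ennreal_ofReal
  have hρm : Measurable fun ζ => pseudoDist z ζ := measurable_pseudoDist.comp measurable_prodMk_left
  have hρp : Measurable fun ζ => ENNReal.ofReal (pseudoDist z ζ) ^ (-ε) :=
    hρm.ennreal_ofReal.pow_const _
  have hpi := Real.pi_gt_three
  set g : ENNReal := ∫⁻ ζ, ENNReal.ofReal (-Real.log (pseudoDist z ζ)) ∂(zeroMeasure f) with hg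
  set b : ENNReal := ∫⁻ ζ, ENNReal.ofReal (1 / (2 * Real.pi)) * ENNReal.ofReal (boxKernel z ζ) ∂ψ
    with hb
  have hgtop : g ≠ ⊤ := by
    have hle : g ≤ ∫⁻ ζ, ENNReal.ofReal
        (4 / (1 / 2) * (1 / (1 - ‖z‖) ^ 2) * (η / 2) ^ (-(1 / 2) : ℝ)) *
          ENNReal.ofReal (1 - ‖ζ‖) ∂(zeroMeasure f) := by
      refine lintegral_mono_ae ?_
      filter_upwards [hμ, hη1] with ζ h1 h2
      rw [← ENNReal.ofReal_mul (by positivity)]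
      exact ENNReal.ofReal_le_ofReal (neg_log_pseudoDist_le_of_le_norm_sub hz1 h1.le hη h2)
    refine ne_top_of_le_ne_top ?_ hle
    rw [lintegral_const_mul' _ _ ENNReal.ofReal_ne_top]
    exact ENNReal.mul_ne_top ENNReal.ofReal_ne_top hψ.blaschke.ne
  have hbtop : b ≠ ⊤ := by
    have hle : b ≤ ∫⁻ _, ENNReal.ofReal (1 / (2 * Real.pi)) *
        ENNReal.ofReal (1 / (1 - ‖z‖) ^ 2) ∂ψ := by
      refine lintegral_mono_ae ?_
      filter_upwards [hψ1] with ζ h1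
      gcongr
      exact boxKernel_le hz1 h1.le
    refine ne_top_of_le_ne_top ?_ hle
    rw [lintegral_const]
    finiteness
  have hgint : ∫ ζ, Real.log (‖z - ζ‖ / ‖1 - z * (starRingEnd ℂ) ζ‖) ∂(zeroMeasure f) =
      -g.toReal := integral_log_pseudoDist f hz1
  have hbint : (1 / (2 * Real.pi)) * (∫ ζ, (1 - ‖z‖ ^ 2) / ‖ζ - z‖ ^ 2 ∂ψ) = b.toReal := by
    have e : ∫ ζ, (1 - ‖z‖ ^ 2) / ‖ζ - z‖ ^ 2 ∂ψ = ∫ ζ, boxKernel z ζ ∂ψ := by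
      refine integral_congr_ae ?_
      filter_upwards [hψ1] with ζ h1
      rw [boxKernel, ← norm_sub_eq_of_norm_eq_one h1, norm_sub_rev]
    rw [e, hb, lintegral_const_mul' _ _ ENNReal.ofReal_ne_top, ENNReal.toReal_mul,
      ENNReal.toReal_ofReal (by positivity), integral_eq_lintegral_of_nonneg_ae]
    · exact ae_of_all _ fun ζ => boxKernel_nonneg hz1.le ζ
    · exact (measurable_boxKernel.comp measurable_prodMk_left).aestronglyMeasurable
  refine ⟨g + b, ENNReal.add_ne_top.mpr ⟨hgtop, hbtop⟩, ?_, ?_, ?_⟩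
  · rw [hC z hz hfz, hgint, hbint, ENNReal.toReal_add hgtop hbtop]
    ring
  · rw [kernelIntegral, lintegral_completeMeasure f ψ hkm, mul_add,
      ← lintegral_const_mul' _ _ ENNReal.ofReal_ne_top,
      ← lintegral_const_mul' _ _ ENNReal.ofReal_ne_top]
    refine add_le_add (lintegral_mono_ae ?_) le_rfl
    filter_upwards [hμ, hη1] with ζ h1 h2
    have hne : z ≠ ζ := by
      rintro rfl
      rw [sub_self, norm_zero] at h2
      linarith
    have h3 := boxKernel_mul_le_neg_log hz1 h1.le hne
    have h4 : 0 ≤ boxKernel z ζ * (1 - ‖ζ‖) :=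
      mul_nonneg (boxKernel_nonneg hz1.le ζ) (by linarith)
    rw [← ENNReal.ofReal_mul (by linarith), ← ENNReal.ofReal_mul (by positivity)]
    refine ENNReal.ofReal_le_ofReal ?_
    -- The Green part allows the constant `1/2`, the Poisson part exactly `1/(2π)`; the smaller one
    -- serves for both.
    have h5 : 1 / (2 * Real.pi) ≤ 1 / 2 := by
      rw [div_le_div_iff₀ (by positivity) (by norm_num)]; linarith
    nlinarith [mul_le_mul_of_nonneg_right h5 h4]
  · have hm : Measurable fun ζ =>
        ENNReal.ofReal (boxKernel z ζ) * ENNReal.ofReal (pseudoDist z ζ) ^ (-ε) := hkm.mul hρp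
    rw [singularIntegral, lintegral_completeMeasure f ψ hm, mul_add,
      ← lintegral_const_mul' _ _ ENNReal.ofReal_ne_top,
      ← lintegral_const_mul' _ _ ENNReal.ofReal_ne_top]
    refine add_le_add (lintegral_mono_ae ?_) (lintegral_mono_ae ?_)
    · filter_upwards [hμ, hη1] with ζ h1 h2
      have hne : z ≠ ζ := by
        rintro rfl
        rw [sub_self, norm_zero] at h2
        linarith
      have hpos : 0 < pseudoDist z ζ :=
        div_pos (norm_pos_iff.mpr (sub_ne_zero.mpr hne)) (norm_one_sub_mul_conj_pos hz1 h1.le)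
      have hk0 := boxKernel_nonneg hz1.le ζ
      have hr0 := Real.rpow_nonneg hpos.le (-ε)
      rw [ENNReal.ofReal_rpow_of_pos hpos, ← ENNReal.ofReal_mul hk0,
        ← ENNReal.ofReal_mul (by linarith), ← ENNReal.ofReal_mul (by positivity)]
      refine ENNReal.ofReal_le_ofReal
        ((neg_log_pseudoDist_le hε hε1 hz1 h1.le hne).trans (le_of_eq ?_))
      ring
    · filter_upwards [hψ1] with ζ h1
      rw [pseudoDist_eq_one hz1 h1, ENNReal.ofReal_one, ENNReal.one_rpow, mul_one]
      refine mul_le_mul_left (ENNReal.ofReal_le_ofReal ?_) _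
      calc 1 / (2 * Real.pi) ≤ 1 := by
            rw [div_le_one (by positivity)]; linarith
        _ ≤ 4 / ε := by rw [le_div_iff₀ hε]; linarith

end

/-! ### Integral means as integrals with values in `[0, ∞]`. -/

lemma finite_zeros_closedBall {f : ℂ → ℂ} (hf : DifferentiableOn ℂ f (Metric.ball (0 : ℂ) 1))
    (hne : ∃ z ∈ Metric.ball (0 : ℂ) 1, f z ≠ 0) {r : ℝ} (hr1 : r < 1) :
    {z ∈ Metric.closedBall (0 : ℂ) r | f z = 0}.Finite := by
  obtain ⟨x, hx, hfx⟩ := hne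
  have h1 := (hf.analyticOnNhd Metric.isOpen_ball).preimage_zero_mem_codiscreteWithin hfx hx
    ((convex_ball (0 : ℂ) 1).isConnected ⟨x, hx⟩)
  have h2 := codiscreteWithin_mono (Metric.closedBall_subset_ball hr1) h1
  refine ((isCompact_closedBall (0 : ℂ) r).finite_sdiff_of_mem_codiscreteWithin h2).subset ?_
  rintro z ⟨hz, hfz⟩
  exact ⟨hz, by simpa using hfz⟩

lemma ae_ne_zero_polarPt {f : ℂ → ℂ} (hf : DifferentiableOn ℂ f (Metric.ball (0 : ℂ) 1))
    (hne : ∃ z ∈ Metric.ball (0 : ℂ) 1, f z ≠ 0) {r : ℝ} (hr0 : 0 < r) (hr1 : r < 1) :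
    ∀ᵐ θ : ℝ, f (polarPt r θ) ≠ 0 := by
  have h := ((finite_zeros_closedBall hf hne hr1).countable.preimage_circleMap 0 hr0.ne').ae_notMem
    (volume : Measure ℝ)
  filter_upwards [h] with θ hθ h0
  refine hθ ⟨?_, ?_⟩
  · simp [abs_of_pos hr0]
  · rw [circleMap_zero]; exact h0

lemma continuous_comp_polarPt {f : ℂ → ℂ} (hf : DifferentiableOn ℂ f (Metric.ball (0 : ℂ) 1))
    {r : ℝ} (hr0 : 0 ≤ r) (hr1 : r < 1) : Continuous fun θ => f (polarPt r θ) :=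
  hf.continuousOn.comp_continuous (continuous_polarPt r) fun θ => by
    rw [mem_ball_zero_iff, norm_polarPt hr0]; exact hr1

/-- The integral of `|log |f||^p` over the circle of radius `r`, with values in `[0, ∞]`. -/
noncomputable def logIntegral (p : ℝ) (f : ℂ → ℂ) (r : ℝ) : ENNReal :=
  ∫⁻ θ in Set.Ioc 0 (2 * Real.pi), ENNReal.ofReal |Real.log ‖f (polarPt r θ)‖| ^ p

/-- The integral over `φ` of the `p`-th power of the measure of the Carleson box, with values in
`[0, ∞]`. -/
noncomputable def boxIntegral (p : ℝ) (Λ : Measure ℂ) (δ : ℝ) : ENNReal :=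
  ∫⁻ φ in Set.Ioc 0 (2 * Real.pi), Λ (carlesonBox φ δ) ^ p

lemma boxMean_eq {p : ℝ} (hp : 0 ≤ p) (Λ : Measure ℂ) [IsFiniteMeasure Λ] (δ : ℝ) :
    boxMean p Λ δ = (boxIntegral p Λ δ).toReal ^ (1 / p) := by
  unfold boxMean boxIntegral
  rw [intervalIntegral.integral_of_le Real.two_pi_pos.le, integral_eq_lintegral_of_nonneg_ae]
  · congr 2
    refine lintegral_congr fun φ => ?_
    rw [← ENNReal.ofReal_rpow_of_nonneg measureReal_nonneg hp, Measure.real,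
      ENNReal.ofReal_toReal (measure_ne_top _ _)]
  · exact ae_of_all _ fun φ => Real.rpow_nonneg measureReal_nonneg _
  · exact ((measurable_measure_carlesonBox Λ δ).ennreal_toReal.pow_const p).aestronglyMeasurable

lemma logMean_eq {p : ℝ} (hp : 0 ≤ p) {f : ℂ → ℂ}
    (hf : DifferentiableOn ℂ f (Metric.ball (0 : ℂ) 1)) {r : ℝ} (hr0 : 0 ≤ r) (hr1 : r < 1) :
    logMean p f r = (1 / (2 * Real.pi) * (logIntegral p f r).toReal) ^ (1 / p) := by
  unfold logMean logIntegral
  rw [intervalIntegral.integral_of_le Real.two_pi_pos.le, integral_eq_lintegral_of_nonneg_ae]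
  · congr 3
    refine lintegral_congr fun θ => ?_
    rw [← ENNReal.ofReal_rpow_of_nonneg (abs_nonneg _) hp]
    rfl
  · exact ae_of_all _ fun θ => Real.rpow_nonneg (abs_nonneg _) _
  · have := (continuous_comp_polarPt hf hr0 hr1).measurable
    exact ((Real.measurable_log.comp this.norm).abs.pow_const p).aestronglyMeasurable

lemma boxIntegral_le (p : ℝ) (hp : 0 ≤ p) (Λ : Measure ℂ) (δ : ℝ) :
    boxIntegral p Λ δ ≤ Λ Set.univ ^ p * ENNReal.ofReal (2 * Real.pi) := by
  unfold boxIntegral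
  calc ∫⁻ φ in Set.Ioc 0 (2 * Real.pi), Λ (carlesonBox φ δ) ^ p
      ≤ ∫⁻ _ in Set.Ioc 0 (2 * Real.pi), Λ Set.univ ^ p :=
        lintegral_mono fun φ => ENNReal.rpow_le_rpow (measure_mono (Set.subset_univ _)) hp
    _ = _ := by rw [setLIntegral_const, Real.volume_Ioc, sub_zero]

lemma boxIntegral_ne_top (p : ℝ) (hp : 0 ≤ p) (Λ : Measure ℂ) [IsFiniteMeasure Λ] (δ : ℝ) :
    boxIntegral p Λ δ ≠ ⊤ :=
  ne_top_of_le_ne_top (ENNReal.mul_ne_top (ENNReal.rpow_ne_top_of_nonneg hp (measure_ne_top _ _))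
    ENNReal.ofReal_ne_top) (boxIntegral_le p hp Λ δ)

lemma toReal_rpow_one_div_le {p s t : ℝ} (hp : 0 < p) (ht : 0 < t) {x B : ENNReal} (hB : B ≠ ⊤)
    (h : x ≤ B * ENNReal.ofReal t ^ (s * p)) :
    x.toReal ^ (1 / p) ≤ B.toReal ^ (1 / p) * t ^ s := by
  have htop : B * ENNReal.ofReal t ^ (s * p) ≠ ⊤ := by
    rw [ENNReal.ofReal_rpow_of_pos ht]; finiteness
  have h1 := ENNReal.toReal_mono htop h
  rw [ENNReal.toReal_mul, ENNReal.ofReal_rpow_of_pos ht,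
    ENNReal.toReal_ofReal (Real.rpow_nonneg ht.le _)] at h1
  calc x.toReal ^ (1 / p) ≤ (B.toReal * t ^ (s * p)) ^ (1 / p) := by gcongr
    _ = B.toReal ^ (1 / p) * t ^ s := by
        rw [Real.mul_rpow ENNReal.toReal_nonneg (Real.rpow_nonneg ht.le _), ← Real.rpow_mul ht.le]
        congr 2
        field_simp

lemma le_mul_ofReal_rpow {p s t K : ℝ} (hp : 0 < p) (ht : 0 < t) {x : ENNReal} (hx : x ≠ ⊤)
    (h : x.toReal ^ (1 / p) ≤ K * t ^ s) :
    x ≤ ENNReal.ofReal (|K| ^ p) * ENNReal.ofReal t ^ (s * p) := by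
  rw [ENNReal.ofReal_rpow_of_pos ht, ← ENNReal.ofReal_mul (by positivity),
    ENNReal.le_ofReal_iff_toReal_le hx (by positivity)]
  have h1 : x.toReal ^ (1 / p) ≤ |K| * t ^ s :=
    h.trans (mul_le_mul_of_nonneg_right (le_abs_self K) (by positivity))
  calc x.toReal = (x.toReal ^ (1 / p)) ^ p := by
        rw [← Real.rpow_mul ENNReal.toReal_nonneg, one_div_mul_cancel hp.ne', Real.rpow_one]
    _ ≤ (|K| * t ^ s) ^ p := by gcongr
    _ = |K| ^ p * t ^ (s * p) := by
        rw [Real.mul_rpow (abs_nonneg _) (by positivity), ← Real.rpow_mul ht.le]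

/-- The dyadic sum uses boxes of every size, so the bound is extended to `δ ≥ 1`, where the total
mass suffices. -/
lemma boxMean_bound_iff {p : ℝ} (hp : 0 < p) {γ : ℝ} (hγ : 0 < γ) (Λ : Measure ℂ)
    [IsFiniteMeasure Λ] :
    (∃ K : ℝ, ∀ δ ∈ Set.Ioo (0 : ℝ) 1, boxMean p Λ δ ≤ K * δ ^ γ) ↔
      ∃ B : ENNReal, B ≠ ⊤ ∧ ∀ δ : ℝ, 0 < δ →
        boxIntegral p Λ δ ≤ B * ENNReal.ofReal δ ^ (γ * p) := by
  constructor
  · rintro ⟨K, hK⟩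
    refine ⟨max (ENNReal.ofReal (|K| ^ p)) (Λ Set.univ ^ p * ENNReal.ofReal (2 * Real.pi)), ?_,
      fun δ hδ => ?_⟩
    · exact max_ne_top ENNReal.ofReal_ne_top (ENNReal.mul_ne_top
        (ENNReal.rpow_ne_top_of_nonneg hp.le (measure_ne_top _ _)) ENNReal.ofReal_ne_top)
    · rcases lt_or_ge δ 1 with h1 | h1
      · have := hK δ ⟨hδ, h1⟩
        rw [boxMean_eq hp.le] at this
        exact (le_mul_ofReal_rpow hp hδ (boxIntegral_ne_top p hp.le Λ δ) this).trans
          (mul_le_mul_left (le_max_left _ _) _)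
      · refine (boxIntegral_le p hp.le Λ δ).trans ((le_max_right _ _).trans
          (le_mul_of_one_le_right' ?_))
        exact ENNReal.one_le_rpow (by simpa using h1) (by positivity)
  · rintro ⟨B, hB, h⟩
    refine ⟨B.toReal ^ (1 / p), fun δ hδ => ?_⟩
    rw [boxMean_eq hp.le]
    exact toReal_rpow_one_div_le hp hδ.1 hB (h δ hδ.1)

/-- The finiteness assumption excludes the default value `0` that the real integral takes when the
integrand is not integrable; without it a bound on `logMean` would carry no information. -/
lemma logMean_isBigO_iff {p : ℝ} (hp : 0 < p) {γ : ℝ} {f : ℂ → ℂ}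
    (hf : DifferentiableOn ℂ f (Metric.ball (0 : ℂ) 1))
    (hfin : ∀ r : ℝ, 1 / 2 ≤ r → r < 1 → logIntegral p f r ≠ ⊤) :
    ((fun r : ℝ => logMean p f r) =O[𝓝[<] 1] (fun r : ℝ => (1 - r) ^ (γ - 1))) ↔
      ∃ B : ENNReal, B ≠ ⊤ ∧ ∃ r₀ : ℝ, r₀ < 1 ∧ ∀ r, r₀ < r → r < 1 →
        logIntegral p f r ≤ B * ENNReal.ofReal (1 - r) ^ ((γ - 1) * p) := by
  have hpi := Real.pi_pos
  constructor
  · intro h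
    obtain ⟨c, hc⟩ := h.bound
    obtain ⟨r₁, hr₁, h1⟩ := mem_nhdsLT_iff_exists_Ioo_subset.mp hc
    refine ⟨ENNReal.ofReal (|c * (2 * Real.pi) ^ (1 / p)| ^ p), ENNReal.ofReal_ne_top,
      max r₁ (1 / 2), max_lt hr₁ (by norm_num), fun r hr hr1 => ?_⟩
    have hr2 : 1 / 2 < r := (le_max_right _ _).trans_lt hr
    have h2 : ‖logMean p f r‖ ≤ c * ‖(1 - r) ^ (γ - 1)‖ := h1 ⟨(le_max_left _ _).trans_lt hr, hr1⟩
    have h3 := (le_abs_self _).trans h2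
    rw [logMean_eq hp.le hf (by linarith) hr1, Real.norm_of_nonneg
      (Real.rpow_nonneg (by linarith) _), Real.mul_rpow (by positivity)
      ENNReal.toReal_nonneg] at h3
    refine le_mul_ofReal_rpow hp (by linarith) (hfin r hr2.le hr1) ?_
    have e : (2 * Real.pi) ^ (1 / p) * (1 / (2 * Real.pi)) ^ (1 / p) = 1 := by
      rw [← Real.mul_rpow (by positivity) (by positivity), mul_one_div_cancel (by positivity),
        Real.one_rpow]
    calc (logIntegral p f r).toReal ^ (1 / p)
        = (2 * Real.pi) ^ (1 / p) *
            ((1 / (2 * Real.pi)) ^ (1 / p) * (logIntegral p f r).toReal ^ (1 / p)) := by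
          rw [← mul_assoc, e, one_mul]
      _ ≤ (2 * Real.pi) ^ (1 / p) * (c * (1 - r) ^ (γ - 1)) := by gcongr
      _ = _ := by ring
  · rintro ⟨B, hB, r₀, hr₀, h⟩
    refine IsBigO.of_bound ((1 / (2 * Real.pi)) ^ (1 / p) * B.toReal ^ (1 / p)) ?_
    have hmem : Set.Ioo (max r₀ (1 / 2)) 1 ∈ 𝓝[<] (1 : ℝ) :=
      Ioo_mem_nhdsLT (max_lt hr₀ (by norm_num))
    filter_upwards [hmem] with r hr
    have hr2 : 1 / 2 < r := (le_max_right _ _).trans_lt hr.1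
    rw [logMean_eq hp.le hf (by linarith) hr.2, Real.mul_rpow (by positivity)
      ENNReal.toReal_nonneg, Real.norm_of_nonneg (by positivity), Real.norm_of_nonneg
      (Real.rpow_nonneg (by linarith [hr.2]) _), mul_assoc]
    gcongr
    exact toReal_rpow_one_div_le hp (by linarith [hr.2]) hB
      (h r ((le_max_left _ _).trans_lt hr.1) hr.2)

/-! ### The two inequalities between means and boxes, and the equivalence. -/

section Equivalence

variable {f : ℂ → ℂ} {Λ : Measure ℂ} {p C : ℝ}

lemma logIntegral_le_singularIntegral (hf : DifferentiableOn ℂ f (Metric.ball (0 : ℂ) 1))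
    (hne : ∃ z ∈ Metric.ball (0 : ℂ) 1, f z ≠ 0) (hp : 1 < p) {ε : ℝ}
    (hC : ∀ z ∈ Metric.ball (0 : ℂ) 1, f z ≠ 0 → ∃ v : ENNReal, v ≠ ⊤ ∧
      Real.log ‖f z‖ = C - v.toReal ∧
      ENNReal.ofReal (1 / (2 * Real.pi)) * kernelIntegral Λ z ≤ v ∧
      v ≤ ENNReal.ofReal (4 / ε) * singularIntegral ε Λ z)
    {r : ℝ} (hr0 : 0 < r) (hr1 : r < 1) :
    logIntegral p f r ≤ 2 ^ (p - 1) * (ENNReal.ofReal |C| ^ p * ENNReal.ofReal (2 * Real.pi) +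
      ENNReal.ofReal (4 / ε) ^ p *
        ∫⁻ φ in Set.Ioc 0 (2 * Real.pi), singularIntegral ε Λ (polarPt r φ) ^ p) := by
  have hp0 : 0 ≤ p := by linarith
  calc logIntegral p f r
      ≤ ∫⁻ φ in Set.Ioc 0 (2 * Real.pi), 2 ^ (p - 1) * (ENNReal.ofReal |C| ^ p +
          ENNReal.ofReal (4 / ε) ^ p * singularIntegral ε Λ (polarPt r φ) ^ p) := by
        refine lintegral_mono_ae ?_
        filter_upwards [ae_restrict_of_ae (ae_ne_zero_polarPt hf hne hr0 hr1)] with φ hφ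
        obtain ⟨v, hv, h1, -, h2⟩ := hC (polarPt r φ)
          (by rw [mem_ball_zero_iff, norm_polarPt hr0.le]; exact hr1) hφ
        have h3 : ENNReal.ofReal |Real.log ‖f (polarPt r φ)‖| ≤ ENNReal.ofReal |C| + v := by
          rw [← ENNReal.ofReal_toReal hv, ← ENNReal.ofReal_add (abs_nonneg _)
            ENNReal.toReal_nonneg, h1]
          refine ENNReal.ofReal_le_ofReal ((abs_sub _ _).trans (le_of_eq ?_))
          rw [abs_of_nonneg (ENNReal.toReal_nonneg (a := v))]
        refine (ENNReal.rpow_le_rpow (h3.trans (add_le_add le_rfl h2)) hp0).trans ?_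
        refine (ENNReal.rpow_add_le_mul_rpow_add_rpow _ _ hp.le).trans (le_of_eq ?_)
        rw [ENNReal.mul_rpow_of_nonneg _ _ hp0]
    _ = _ := by
        rw [lintegral_const_mul' _ _ (ENNReal.rpow_ne_top_of_nonneg (by linarith) (by norm_num)),
          lintegral_add_left measurable_const, setLIntegral_const, Real.volume_Ioc, sub_zero,
          lintegral_const_mul' _ _ (ENNReal.rpow_ne_top_of_nonneg hp0 ENNReal.ofReal_ne_top)]

lemma boxIntegral_le_logIntegral [IsFiniteMeasure Λ] (hΛ : Λ (Metric.closedBall 0 1)ᶜ = 0)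
    (hf : DifferentiableOn ℂ f (Metric.ball (0 : ℂ) 1))
    (hne : ∃ z ∈ Metric.ball (0 : ℂ) 1, f z ≠ 0) (hp : 1 < p)
    (hC : ∀ z ∈ Metric.ball (0 : ℂ) 1, f z ≠ 0 → ∃ v : ENNReal, v ≠ ⊤ ∧
      Real.log ‖f z‖ = C - v.toReal ∧
      ENNReal.ofReal (1 / (2 * Real.pi)) * kernelIntegral Λ z ≤ v)
    {δ : ℝ} (hδ0 : 0 < δ) (hδ1 : δ < 1) :
    boxIntegral p Λ δ ≤ ENNReal.ofReal (72 * Real.pi * δ) ^ p * (2 ^ (p - 1) *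
      (ENNReal.ofReal |C| ^ p * ENNReal.ofReal (2 * Real.pi) + logIntegral p f (1 - δ))) := by
  have hp0 : 0 ≤ p := by linarith
  have hpi := Real.pi_pos
  calc boxIntegral p Λ δ
      ≤ ∫⁻ φ in Set.Ioc 0 (2 * Real.pi), ENNReal.ofReal (72 * Real.pi * δ) ^ p * (2 ^ (p - 1) *
          (ENNReal.ofReal |C| ^ p +
            ENNReal.ofReal |Real.log ‖f (polarPt (1 - δ) φ)‖| ^ p)) := by
        refine lintegral_mono_ae ?_
        filter_upwards [ae_restrict_of_ae
          (ae_ne_zero_polarPt hf hne (r := 1 - δ) (by linarith) (by linarith))] with φ hφ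
        obtain ⟨v, hv, h1, h2⟩ := hC (polarPt (1 - δ) φ)
          (by rw [mem_ball_zero_iff, norm_polarPt (by linarith)]; linarith) hφ
        have h3 : v ≤ ENNReal.ofReal |C| + ENNReal.ofReal |Real.log ‖f (polarPt (1 - δ) φ)‖| := by
          rw [← ENNReal.ofReal_toReal hv, ← ENNReal.ofReal_add (abs_nonneg _) (abs_nonneg _)]
          refine ENNReal.ofReal_le_ofReal ?_
          linarith [le_abs_self C, neg_abs_le (Real.log ‖f (polarPt (1 - δ) φ)‖)]
        have h4 : Λ (carlesonBox φ δ) ≤ ENNReal.ofReal (72 * Real.pi * δ) *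
            (ENNReal.ofReal |C| + ENNReal.ofReal |Real.log ‖f (polarPt (1 - δ) φ)‖|) := by
          refine (measure_carlesonBox_le_kernelIntegral hδ0 hδ1 hΛ).trans ?_
          -- The lower bound for `v` carries the factor `1/(2π)`, which turns `36δ` into `72πδ`.
          have e : ENNReal.ofReal (36 * δ) = ENNReal.ofReal (72 * Real.pi * δ) *
              ENNReal.ofReal (1 / (2 * Real.pi)) := by
            rw [← ENNReal.ofReal_mul (by positivity)]
            congr 1
            field_simp
            norm_num
          rw [e, mul_assoc]
          exact mul_le_mul_right (h2.trans h3) _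
        refine (ENNReal.rpow_le_rpow h4 hp0).trans ?_
        rw [ENNReal.mul_rpow_of_nonneg _ _ hp0]
        exact mul_le_mul_right (ENNReal.rpow_add_le_mul_rpow_add_rpow _ _ hp.le) _
    _ = _ := by
        rw [lintegral_const_mul' _ _ (ENNReal.rpow_ne_top_of_nonneg hp0 ENNReal.ofReal_ne_top),
          lintegral_const_mul' _ _ (ENNReal.rpow_ne_top_of_nonneg (by linarith) (by norm_num)),
          lintegral_add_left measurable_const, setLIntegral_const, Real.volume_Ioc, sub_zero]
        rfl

end Equivalence

theorem logMean_isBigO_iff_boxMean_le {f : ℂ → ℂ} {ψ : Measure ℂ}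
    (hf : DifferentiableOn ℂ f (Metric.ball (0 : ℂ) 1))
    (hne : ∃ z ∈ Metric.ball (0 : ℂ) 1, f z ≠ 0) (hψ : IsBoundaryMeasure f ψ) {γ p : ℝ}
    (hγ : γ ∈ Set.Ioc (0 : ℝ) 1) (hp : 1 < p) :
    ((fun r : ℝ => logMean p f r) =O[𝓝[<] 1] (fun r : ℝ => (1 - r) ^ (γ - 1)) ↔
      ∃ K : ℝ, ∀ δ ∈ Set.Ioo (0 : ℝ) 1, boxMean p (completeMeasure f ψ) δ ≤ K * δ ^ γ) := by
  have hp0 : 0 < p := by linarith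
  have hfinΛ := hψ.isFiniteMeasure_completeMeasure
  have hΛ := hψ.completeMeasure_compl
  set Λ := completeMeasure f ψ
  obtain ⟨C, hC⟩ := hψ.exists_potential hf (ε := 1 / (2 * p)) (by positivity)
    (by rw [div_le_div_iff₀ (by positivity) (by norm_num)]; linarith)
  have hCK : ENNReal.ofReal (4 / (1 / (2 * p))) ^ p ≠ ⊤ :=
    ENNReal.rpow_ne_top_of_nonneg hp0.le ENNReal.ofReal_ne_top
  have hCC : ENNReal.ofReal |C| ^ p ≠ ⊤ :=
    ENNReal.rpow_ne_top_of_nonneg hp0.le ENNReal.ofReal_ne_top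
  have h2p : (2 : ENNReal) ^ (p - 1) ≠ ⊤ :=
    ENNReal.rpow_ne_top_of_nonneg (by linarith) (by norm_num)
  have hUtop : Λ Set.univ ^ p * ENNReal.ofReal (2 * Real.pi) ≠ ⊤ :=
    ENNReal.mul_ne_top (ENNReal.rpow_ne_top_of_nonneg hp0.le (measure_ne_top _ _))
      ENNReal.ofReal_ne_top
  -- Finiteness needs no box condition: the case `q = 0` of the box estimate, with the trivial bound
  -- by the total mass, already gives it.
  have hfin : ∀ r : ℝ, 1 / 2 ≤ r → r < 1 → logIntegral p f r ≠ ⊤ := by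
    intro r hr hr1
    obtain ⟨A, hA, h⟩ := setLIntegral_singularIntegral_le_of_box hΛ hp le_rfl hp0.le hUtop
      (fun δ _ => by
        rw [ENNReal.rpow_zero, mul_one]
        exact boxIntegral_le p hp0.le Λ δ)
    have h1 := h r hr hr1
    have h2 : A * ENNReal.ofReal (1 - r) ^ (0 - p) ≠ ⊤ := by
      rw [ENNReal.ofReal_rpow_of_pos (by linarith)]; finiteness
    have h3 := ne_top_of_le_ne_top h2 h1
    refine ne_top_of_le_ne_top ?_ (logIntegral_le_singularIntegral hf hne hp hC
      (by linarith) hr1)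
    finiteness
  -- Since `γ ≤ 1`, the additive constant coming from `C` is absorbed into the growth rate.
  have hone : ∀ t : ℝ, 0 < t → t ≤ 1 → 1 ≤ ENNReal.ofReal t ^ ((γ - 1) * p) := by
    intro t ht ht1
    rw [ENNReal.ofReal_rpow_of_pos ht, ENNReal.one_le_ofReal]
    exact Real.one_le_rpow_of_pos_of_le_one_of_nonpos ht ht1
      (mul_nonpos_of_nonpos_of_nonneg (by linarith [hγ.2]) hp0.le)
  rw [logMean_isBigO_iff hp0 hf hfin, boxMean_bound_iff hp0 hγ.1]
  constructor
  · rintro ⟨B, hB, r₀, hr₀, h⟩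
    -- The bound on the means holds only for `r` near `1`, so it controls boxes with `δ < δ₀`;
    -- larger boxes are bounded by the total mass.
    set δ₀ := min (1 - r₀) 1 with hδ₀
    have hδ₀pos : 0 < δ₀ := lt_min (by linarith) one_pos
    set M := ENNReal.ofReal (72 * Real.pi) ^ p * (2 ^ (p - 1) *
      (ENNReal.ofReal |C| ^ p * ENNReal.ofReal (2 * Real.pi) + B)) with hM
    set U := Λ Set.univ ^ p * ENNReal.ofReal (2 * Real.pi)
    have hMtop : M ≠ ⊤ := by
      have : ENNReal.ofReal (72 * Real.pi) ^ p ≠ ⊤ :=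
        ENNReal.rpow_ne_top_of_nonneg hp0.le ENNReal.ofReal_ne_top
      finiteness
    refine ⟨M + U * ENNReal.ofReal (δ₀ ^ (-(γ * p))), by finiteness, fun δ hδ => ?_⟩
    rcases lt_or_ge δ δ₀ with hlt | hge
    · have hδ1 : δ < 1 := hlt.trans_le (min_le_right _ _)
      have h1 := boxIntegral_le_logIntegral hΛ hf hne hp
        (fun z hz hfz => by
          obtain ⟨v, hv, h1, h2, -⟩ := hC z hz hfz
          exact ⟨v, hv, h1, h2⟩) hδ hδ1
      have h2 := h (1 - δ) (by linarith [min_le_left (1 - r₀) 1]) (by linarith)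
      rw [sub_sub_cancel] at h2
      have h3 := hone δ hδ hδ1.le
      set T := ENNReal.ofReal δ ^ ((γ - 1) * p) with hT
      calc boxIntegral p Λ δ ≤ ENNReal.ofReal (72 * Real.pi * δ) ^ p * (2 ^ (p - 1) *
            (ENNReal.ofReal |C| ^ p * ENNReal.ofReal (2 * Real.pi) * T + B * T)) := by
            refine h1.trans ?_
            exact mul_le_mul_right (mul_le_mul_right
              (add_le_add (le_mul_of_one_le_right' h3) h2) _) _
        _ = M * (ENNReal.ofReal δ ^ p * T) := by
            rw [ENNReal.ofReal_mul (by positivity), ENNReal.mul_rpow_of_nonneg _ _ hp0.le, hM]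
            ring
        _ = M * ENNReal.ofReal δ ^ (γ * p) := by
            rw [hT, ← ENNReal.rpow_add _ _ (by simpa using hδ) ENNReal.ofReal_ne_top]
            ring_nf
        _ ≤ _ := by
            gcongr
            exact le_self_add
    · calc boxIntegral p Λ δ ≤ U := boxIntegral_le p hp0.le Λ δ
        _ ≤ U * (ENNReal.ofReal (δ₀ ^ (-(γ * p))) * ENNReal.ofReal δ ^ (γ * p)) := by
            refine le_mul_of_one_le_right' ?_
            rw [ENNReal.ofReal_rpow_of_pos hδ, ← ENNReal.ofReal_mul (by positivity),
              ENNReal.one_le_ofReal, Real.rpow_neg hδ₀pos.le, ← div_eq_inv_mul,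
              one_le_div (by positivity)]
            exact Real.rpow_le_rpow hδ₀pos.le hge (by have := hγ.1; positivity)
        _ ≤ _ := by
            rw [← mul_assoc]
            gcongr
            exact le_add_self
  · rintro ⟨B, hB, h⟩
    obtain ⟨A, hA, h1⟩ := setLIntegral_singularIntegral_le_of_box hΛ hp
      (mul_nonneg hγ.1.le hp0.le) (by nlinarith [hγ.2]) hB h
    refine ⟨2 ^ (p - 1) * (ENNReal.ofReal |C| ^ p * ENNReal.ofReal (2 * Real.pi) +
      ENNReal.ofReal (4 / (1 / (2 * p))) ^ p * A), by finiteness, 1 / 2, by norm_num,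
      fun r hr hr1 => ?_⟩
    refine (logIntegral_le_singularIntegral hf hne hp hC (by linarith) hr1).trans ?_
    have h2 := h1 r hr.le hr1
    rw [show γ * p - p = (γ - 1) * p by ring] at h2
    have h3 := hone (1 - r) (by linarith) (by linarith)
    set T := ENNReal.ofReal (1 - r) ^ ((γ - 1) * p) with hT
    rw [mul_assoc, add_mul, mul_assoc (ENNReal.ofReal (4 / (1 / (2 * p))) ^ p)]
    exact mul_le_mul_right (add_le_add (le_mul_of_one_le_right' h3) (mul_le_mul_right h2 _)) _

/-! ### The Poisson–Jensen formula. -/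

/-- The Green function of the disc of radius `r` about the origin. -/
noncomputable def discGreen (r : ℝ) (w a : ℂ) : ℝ :=
  Real.log (‖(r : ℂ) ^ 2 - (starRingEnd ℂ) a * w‖ / (r * ‖w - a‖))

lemma continuousOn_poissonKernel {r : ℝ} (hr : 0 < r) {w : ℂ} (hw : ‖w‖ < r) :
    ContinuousOn (poissonKernel 0 w) (Metric.sphere 0 |r|) := by
  intro z hz
  have : z - w ≠ 0 := by
    rintro h
    rw [sub_eq_zero] at h
    rw [h, mem_sphere_zero_iff_norm, abs_of_pos hr] at hz
    linarith
  have h2 : ‖z - 0 - (w - 0)‖ ^ 2 ≠ 0 := by simpa using this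
  have e : poissonKernel 0 w =
      fun z => (‖z - 0‖ ^ 2 - ‖w - 0‖ ^ 2) / ‖z - 0 - (w - 0)‖ ^ 2 := by
    ext z; rw [poissonKernel_def]
  refine ContinuousAt.continuousWithinAt ?_
  rw [e]
  exact ContinuousAt.div (by fun_prop) (by fun_prop) h2

lemma norm_sq_sub_conj_mul_pos {r : ℝ} (hr : 0 < r) {u w : ℂ} (hu : ‖u‖ ≤ r) (hw : ‖w‖ < r) :
    0 < ‖(r : ℂ) ^ 2 - (starRingEnd ℂ) u * w‖ := by
  have h1 : ‖(r : ℂ) ^ 2‖ - ‖(starRingEnd ℂ) u * w‖ ≤ ‖(r : ℂ) ^ 2 - (starRingEnd ℂ) u * w‖ :=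
    norm_sub_norm_le _ _
  rw [norm_pow, Complex.norm_real, Real.norm_of_nonneg hr.le, norm_mul, RCLike.norm_conj] at h1
  nlinarith [norm_nonneg u, norm_nonneg w]

lemma norm_sq_sub_conj_mul_of_norm_eq {r : ℝ} {u ζ : ℂ} (hζ : ‖ζ‖ = r) :
    ‖(r : ℂ) ^ 2 - (starRingEnd ℂ) u * ζ‖ = r * ‖ζ - u‖ := by
  have : (r : ℂ) ^ 2 = (starRingEnd ℂ) ζ * ζ := by
    rw [← Complex.normSq_eq_conj_mul_self, Complex.normSq_eq_norm_sq, hζ]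
    push_cast; rfl
  rw [this, ← sub_mul, norm_mul, ← map_sub, RCLike.norm_conj, hζ, mul_comm]

/-- Reflection: on the circle `|ζ - u| = |r² - ūζ|/r`, and for `|u| < r` the right-hand side has no
zero in the closed disc, so its logarithm is harmonic there and is reproduced by the Poisson kernel.
Zeros on the circle itself are a boundary case treated separately. -/
lemma circleAverage_poissonKernel_mul_log_norm_sub {r : ℝ} (hr : 0 < r) {u w : ℂ}
    (hu : ‖u‖ ≤ r) (hw : ‖w‖ < r) :
    Real.circleAverage (poissonKernel 0 w * fun ζ => Real.log ‖ζ - u‖) 0 r =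
      Real.log (‖(r : ℂ) ^ 2 - (starRingEnd ℂ) u * w‖ / r) := by
  rcases hu.eq_or_lt with h | h
  · have h1 := circleAverage_re_herglotzRieszKernel_mul_log (ρ := u) (w := w) (c := 0) (R := r)
      (by simpa using h) (by simpa using hw)
    rw [poissonKernel_eq_re_herglotzRieszKernel]
    refine h1.trans ?_
    have h2 : ‖(r : ℂ) ^ 2 - (starRingEnd ℂ) u * w‖ = r * ‖w - u‖ := by
      have : (r : ℂ) ^ 2 = (starRingEnd ℂ) u * u := by
        rw [← Complex.normSq_eq_conj_mul_self, Complex.normSq_eq_norm_sq, h]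
        push_cast; rfl
      rw [this, ← mul_sub, norm_mul, RCLike.norm_conj, h, norm_sub_rev]
    rw [h2, mul_div_cancel_left₀ _ hr.ne']
  · set g : ℂ → ℂ := fun ζ => ((r : ℂ) ^ 2 - (starRingEnd ℂ) u * ζ) / r with hg
    have hgn : ∀ ζ, ‖g ζ‖ = ‖(r : ℂ) ^ 2 - (starRingEnd ℂ) u * ζ‖ / r := by
      intro ζ
      rw [hg]
      simp [abs_of_pos hr]
    have hharm : InnerProductSpace.HarmonicOnNhd (fun ζ => Real.log ‖g ζ‖)
        (Metric.closedBall 0 r) := by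
      intro ζ hζ
      have hζ' : ‖ζ‖ ≤ r := by simpa using hζ
      have hr' : (r : ℂ) ≠ 0 := by exact_mod_cast hr.ne'
      refine AnalyticAt.harmonicAt_log_norm (by fun_prop (disch := exact hr')) ?_
      rw [← norm_ne_zero_iff, hgn]
      refine (div_pos ?_ hr).ne'
      have h1 : ‖(r : ℂ) ^ 2‖ - ‖(starRingEnd ℂ) u * ζ‖ ≤ ‖(r : ℂ) ^ 2 - (starRingEnd ℂ) u * ζ‖ :=
        norm_sub_norm_le _ _
      rw [norm_pow, Complex.norm_real, Real.norm_of_nonneg hr.le, norm_mul, RCLike.norm_conj] at h1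
      nlinarith [norm_nonneg u, norm_nonneg ζ]
    have h1 := hharm.circleAverage_poissonKernel_smul (w := w) (by simpa using hw)
    rw [hgn] at h1
    rw [← h1]
    refine Real.circleAverage_congr_sphere fun ζ hζ => ?_
    have hζ' : ‖ζ‖ = r := by simpa [abs_of_pos hr] using hζ
    simp only [Pi.mul_apply, Pi.smul_apply', smul_eq_mul]
    rw [hgn, norm_sq_sub_conj_mul_of_norm_eq hζ', mul_div_cancel_left₀ _ hr.ne']

/-- The **Poisson–Jensen formula**. -/
theorem AnalyticOnNhd.poisson_jensen {f : ℂ → ℂ} {r : ℝ} (hr : 0 < r)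
    (hf : AnalyticOnNhd ℂ f (Metric.closedBall 0 r)) {w : ℂ} (hw : ‖w‖ < r) (hfw : f w ≠ 0) :
    ∃ S : Finset ℂ, (∀ u, u ∈ S ↔ u ∈ Metric.closedBall (0 : ℂ) r ∧ f u = 0) ∧
      Real.log ‖f w‖ = Real.circleAverage (poissonKernel 0 w * fun ζ => Real.log ‖f ζ‖) 0 r -
        ∑ u ∈ S, analyticOrderNatAt f u * discGreen r w u := by
  set CB := Metric.closedBall (0 : ℂ) r with hCB
  have habs : |r| = r := abs_of_pos hr
  have hwCB : w ∈ CB := by simpa [hCB] using hw.le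
  have hord : ∀ u ∈ CB, analyticOrderAt f u ≠ ⊤ := fun u hu =>
    hf.analyticOrderAt_ne_top_of_isPreconnected (convex_closedBall (0 : ℂ) r).isPreconnected
      hwCB hu (by rw [(hf w hwCB).analyticOrderAt_eq_zero.mpr hfw]; simp)
  set D := MeromorphicOn.divisor f CB with hD
  have hDn : ∀ u ∈ CB, (D u : ℤ) = analyticOrderNatAt f u := by
    intro u hu
    rw [hD, MeromorphicOn.AnalyticOnNhd.divisor_apply hf hu, ← Nat.cast_analyticOrderNatAt (hord u hu)]
    rfl
  have hfin := D.finiteSupport (isCompact_closedBall (0 : ℂ) r)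
  have hmord : ∀ u : CB, meromorphicOrderAt f u ≠ ⊤ := by
    intro u
    rw [(hf u u.2).meromorphicOrderAt_eq, ← Nat.cast_analyticOrderNatAt (hord u u.2)]
    exact WithTop.coe_ne_top
  -- Factor `f` as a finite product of powers of `z - u` times a zero-free analytic `g`. The
  -- factorisation holds off a discrete set, which the circle averages do not see.
  obtain ⟨g, h₁g, h₂g, h₃g⟩ := hf.meromorphicOn.extract_zeros_poles hmord hfin
  have hlog := MeromorphicOn.extract_zeros_poles_log h₂g h₃g
  have hsum : (∑ᶠ u, fun z : ℂ => (D u : ℝ) * Real.log ‖z - u‖) =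
      ∑ u ∈ hfin.toFinset, fun z : ℂ => (D u : ℝ) * Real.log ‖z - u‖ := by
    refine finsum_eq_sum_of_support_subset _ ?_
    intro u
    contrapose
    intro hu
    have : D u = 0 := by simpa using hu
    simp [this, Pi.zero_def]
  have hsumw : ∑ᶠ u, (D u : ℝ) * Real.log ‖w - u‖ =
      ∑ u ∈ hfin.toFinset, (D u : ℝ) * Real.log ‖w - u‖ := by
    refine finsum_eq_sum_of_support_subset _ ?_
    intro u
    contrapose
    intro hu
    have : D u = 0 := by simpa using hu
    simp [this]
  have hmemS : ∀ u, u ∈ hfin.toFinset ↔ u ∈ CB ∧ f u = 0 := by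
    intro u
    rw [Set.Finite.mem_toFinset, Function.mem_support]
    constructor
    · intro h
      have hu : u ∈ CB := D.supportWithinDomain h
      refine ⟨hu, ?_⟩
      by_contra hcon
      apply h
      rw [hDn u hu, analyticOrderNatAt, (hf u hu).analyticOrderAt_eq_zero.mpr hcon]
      rfl
    · rintro ⟨hu, hfu⟩ h
      rw [hDn u hu, ← Nat.cast_zero, Nat.cast_inj] at h
      have h2 := Nat.cast_analyticOrderNatAt (hord u hu)
      rw [h] at h2
      exact (hf u hu).analyticOrderAt_ne_zero.mpr hfu h2.symm
  have hPc := continuousOn_poissonKernel hr hw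
  have hterm : ∀ u ∈ hfin.toFinset, CircleIntegrable
      (poissonKernel 0 w * fun z => (D u : ℝ) * Real.log ‖z - u‖) 0 r := by
    intro u _
    refine CircleIntegrable.continuousOn_mul ?_ hPc
    refine CircleIntegrable.const_smul (a := (D u : ℝ)) ?_
    exact (analyticOnNhd_id.sub analyticOnNhd_const).meromorphicOn.circleIntegrable_log_norm
  have hgint : CircleIntegrable (poissonKernel 0 w * fun ζ => Real.log ‖g ζ‖) 0 r := by
    refine CircleIntegrable.continuousOn_mul ?_ hPc
    refine MeromorphicOn.circleIntegrable_log_norm ?_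
    rw [habs]
    exact (h₁g.mono Metric.sphere_subset_closedBall).meromorphicOn
  have havg : Real.circleAverage (poissonKernel 0 w * fun ζ => Real.log ‖f ζ‖) 0 r =
      ∑ u ∈ hfin.toFinset, (D u : ℝ) *
        Real.log (‖(r : ℂ) ^ 2 - (starRingEnd ℂ) u * w‖ / r) + Real.log ‖g w‖ := by
    have e1 : Real.circleAverage (poissonKernel 0 w * fun ζ => Real.log ‖f ζ‖) 0 r =
        Real.circleAverage ((∑ u ∈ hfin.toFinset,
          poissonKernel 0 w * fun z => (D u : ℝ) * Real.log ‖z - u‖) +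
          poissonKernel 0 w * fun ζ => Real.log ‖g ζ‖) 0 r := by
      refine Real.circleAverage_congr_codiscreteWithin ?_ hr.ne'
      rw [habs]
      have := codiscreteWithin_mono Metric.sphere_subset_closedBall hlog
      filter_upwards [this] with ζ hζ
      rw [hsum] at hζ
      simp only [Pi.mul_apply, Pi.add_apply, Finset.sum_apply] at hζ ⊢
      rw [hζ, mul_add, Finset.mul_sum]
    rw [e1, Real.circleAverage_add (CircleIntegrable.sum _ hterm) hgint,
      Real.circleAverage_sum hterm]
    congr 1
    · refine Finset.sum_congr rfl fun u hu => ?_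
      have hu' : ‖u‖ ≤ r := by simpa [hCB] using ((hmemS u).mp hu).1
      rw [← circleAverage_poissonKernel_mul_log_norm_sub hr hu' hw,
        ← smul_eq_mul (a := (D u : ℝ)), ← Real.circleAverage_smul]
      congr 1
      ext ζ
      simp only [Pi.mul_apply, Pi.smul_apply, smul_eq_mul]
      ring
    · have hharm : InnerProductSpace.HarmonicOnNhd (fun ζ => Real.log ‖g ζ‖) CB :=
        fun ζ hζ => (h₁g ζ hζ).harmonicAt_log_norm (h₂g ⟨ζ, hζ⟩)
      exact hharm.circleAverage_poissonKernel_smul (w := w) (by simpa using hw)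
  have hlogw : Real.log ‖f w‖ =
      ∑ u ∈ hfin.toFinset, (D u : ℝ) * Real.log ‖w - u‖ + Real.log ‖g w‖ := by
    -- The factorisation is not known at `w` itself; the value there is recovered from leading
    -- coefficients, which needs `w` to be an accumulation point of the disc.
    have hacc : AccPt w (𝓟 CB) := by
      have : CB ∈ 𝓝 w := mem_of_superset (Metric.isOpen_ball.mem_nhds
        (show w ∈ Metric.ball (0 : ℂ) r by simpa using hw)) Metric.ball_subset_closedBall
      rw [accPt_iff_frequently_nhdsNE]
      exact (eventually_nhdsWithin_of_eventually_nhds this).frequently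
    have h := MeromorphicOn.log_norm_meromorphicTrailingCoeffAt_extract_zeros_poles hfin hwCB hacc
      (hf.meromorphicOn w hwCB) (h₁g w hwCB) (h₂g ⟨w, hwCB⟩) h₃g
    rw [(hf w hwCB).meromorphicTrailingCoeffAt_of_ne_zero hfw] at h
    rw [h, ← hsumw]
  refine ⟨hfin.toFinset, hmemS, ?_⟩
  rw [hlogw, havg, add_sub_right_comm, ← Finset.sum_sub_distrib]
  congr 1
  refine Finset.sum_congr rfl fun u hu => ?_
  obtain ⟨hu1, hu2⟩ := (hmemS u).mp hu
  have hu' : ‖u‖ ≤ r := by simpa [hCB] using hu1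
  have hne : 0 < ‖w - u‖ := by
    rw [norm_pos_iff, sub_ne_zero]
    rintro rfl
    exact hfw hu2
  have hpos := norm_sq_sub_conj_mul_pos hr hu' hw
  rw [hDn u hu1, discGreen, ← div_div,
    Real.log_div (x := ‖(r : ℂ) ^ 2 - (starRingEnd ℂ) u * w‖ / r) (by positivity) hne.ne']
  push_cast
  ring

/-! ### Green functions of growing discs and the limit `r → 1`. -/

lemma normSq_sq_sub_conj_mul (r : ℝ) (w a : ℂ) :
    ‖(r : ℂ) ^ 2 - (starRingEnd ℂ) a * w‖ ^ 2 =
      (r * ‖w - a‖) ^ 2 + (r ^ 2 - ‖a‖ ^ 2) * (r ^ 2 - ‖w‖ ^ 2) := by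
  rw [mul_pow]
  simp only [← Complex.normSq_eq_norm_sq, Complex.normSq_apply, ← Complex.ofReal_pow]
  simp [-Complex.ofReal_pow]
  ring

lemma discGreen_nonneg {r : ℝ} (hr : 0 < r) {w a : ℂ} (hw : ‖w‖ < r) (ha : ‖a‖ ≤ r) :
    0 ≤ discGreen r w a := by
  rcases eq_or_ne w a with rfl | hne
  -- At the pole the division by zero makes the value `log 0 = 0`.
  · simp [discGreen]
  have hpos : 0 < r * ‖w - a‖ := mul_pos hr (norm_pos_iff.mpr (sub_ne_zero.mpr hne))
  refine Real.log_nonneg ((one_le_div hpos).mpr ?_)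
  refine (sq_le_sq₀ hpos.le (norm_nonneg _)).mp ?_
  rw [normSq_sq_sub_conj_mul]
  have h1 : 0 ≤ r ^ 2 - ‖a‖ ^ 2 := by nlinarith [norm_nonneg a]
  have h2 : 0 ≤ r ^ 2 - ‖w‖ ^ 2 := by nlinarith [norm_nonneg w]
  nlinarith [mul_nonneg h1 h2]

lemma discGreen_one (w a : ℂ) : discGreen 1 w a = -Real.log (pseudoDist w a) := by
  rw [discGreen, pseudoDist, ← Real.log_inv, inv_div, Complex.ofReal_one, one_pow, one_mul,
    mul_comm w]

/-- The Green function grows with the domain. With `b = āw` this reads `|r² - b| ≤ r|1 - b|`, and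
the difference of the squares is `(1 - r²)(r² - |b|²) ≥ 0`. It supplies the majorant for dominated
convergence. -/
lemma discGreen_le {r : ℝ} (hr : 0 < r) (hr1 : r < 1) {w a : ℂ} (hw : ‖w‖ < r) (ha : ‖a‖ ≤ r)
    (hne : w ≠ a) : discGreen r w a ≤ -Real.log (pseudoDist w a) := by
  have hd : 0 < ‖w - a‖ := norm_pos_iff.mpr (sub_ne_zero.mpr hne)
  have hb : ‖(starRingEnd ℂ) a * w‖ ≤ r ^ 2 := by
    rw [norm_mul, RCLike.norm_conj]
    nlinarith [norm_nonneg a, norm_nonneg w]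
  rw [← discGreen_one, discGreen, discGreen]
  refine Real.log_le_log (div_pos (norm_sq_sub_conj_mul_pos hr ha hw) (by positivity)) ?_
  rw [div_le_div_iff₀ (by positivity) (by positivity), Complex.ofReal_one, one_pow, one_mul]
  set b := (starRingEnd ℂ) a * w
  have h : ‖(r : ℂ) ^ 2 - b‖ ≤ r * ‖1 - b‖ := by
    refine (sq_le_sq₀ (norm_nonneg _) (by positivity)).mp ?_
    have e : (r * ‖1 - b‖) ^ 2 = ‖(r : ℂ) ^ 2 - b‖ ^ 2 + (1 - r ^ 2) * (r ^ 2 - ‖b‖ ^ 2) := by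
      rw [mul_pow]
      simp only [← Complex.normSq_eq_norm_sq, Complex.normSq_apply, ← Complex.ofReal_pow]
      simp [-Complex.ofReal_pow]
      ring
    have h1 : 0 ≤ 1 - r ^ 2 := by nlinarith
    have h2 : 0 ≤ r ^ 2 - ‖b‖ ^ 2 := by nlinarith [norm_nonneg b]
    nlinarith [mul_nonneg h1 h2]
  nlinarith

lemma tendsto_discGreen {w a : ℂ} (hw : ‖w‖ < 1) (ha : ‖a‖ ≤ 1) (hne : w ≠ a) {r : ℕ → ℝ}
    (hr : Tendsto r atTop (𝓝 1)) :
    Tendsto (fun n => discGreen (r n) w a) atTop (𝓝 (-Real.log (pseudoDist w a))) := by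
  have hd : 0 < ‖w - a‖ := norm_pos_iff.mpr (sub_ne_zero.mpr hne)
  have hp := norm_sq_sub_conj_mul_pos one_pos ha hw
  have hc : ContinuousAt (fun s : ℝ => discGreen s w a) 1 := by
    unfold discGreen
    refine ContinuousAt.log (ContinuousAt.div (by fun_prop) (by fun_prop) (by positivity)) ?_
    exact (div_pos hp (by positivity)).ne'
  rw [← discGreen_one]
  exact hc.tendsto.comp hr

/-- The Green function of the disc of radius `r` with pole `w`, extended by zero. -/
noncomputable def truncGreen (r : ℝ) (w : ℂ) : ℂ → ENNReal :=
  (Metric.closedBall 0 r).indicator fun a => ENNReal.ofReal (discGreen r w a)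

lemma measurable_truncGreen (r : ℝ) (w : ℂ) : Measurable (truncGreen r w) := by
  refine Measurable.indicator ?_ Metric.isClosed_closedBall.measurableSet
  unfold discGreen
  have : Measurable (starRingEnd ℂ) := Complex.continuous_conj.measurable
  fun_prop

lemma lintegral_truncGreen {f : ℂ → ℂ} {r : ℝ} (hr : 0 < r) (hr1 : r < 1) {w : ℂ} (hw : ‖w‖ < r)
    {S : Finset ℂ} (hS : ∀ u, u ∈ S ↔ u ∈ Metric.closedBall (0 : ℂ) r ∧ f u = 0) :
    ∫⁻ a, truncGreen r w a ∂(zeroMeasure f) =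
      ENNReal.ofReal (∑ u ∈ S, analyticOrderNatAt f u * discGreen r w u) := by
  rw [lintegral_zeroMeasure,
    tsum_subtype (discZeros f) fun a => (analyticOrderNatAt f a : ENNReal) * truncGreen r w a,
    tsum_eq_sum (s := S), ENNReal.ofReal_sum_of_nonneg]
  · refine Finset.sum_congr rfl fun u hu => ?_
    obtain ⟨h1, h2⟩ := (hS u).mp hu
    rw [Set.indicator_of_mem, truncGreen, Set.indicator_of_mem h1,
      ENNReal.ofReal_mul (by positivity), ENNReal.ofReal_natCast]
    exact ⟨Metric.closedBall_subset_ball hr1 h1, h2⟩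
  · intro u hu
    have h1 := ((hS u).mp hu).1
    exact mul_nonneg (by positivity) (discGreen_nonneg hr hw (by simpa using h1))
  · intro u hu
    by_cases h2 : u ∈ discZeros f
    · have h1 : u ∉ Metric.closedBall (0 : ℂ) r := fun h => hu ((hS u).mpr ⟨h, h2.2⟩)
      rw [Set.indicator_of_mem h2, truncGreen, Set.indicator_of_notMem h1, mul_zero]
    · exact Set.indicator_of_notMem h2 _

/-- The Poisson integral over the circle of radius `r` of `L - log |f|`. -/
noncomputable def poissonMean (f : ℂ → ℂ) (L r : ℝ) (w : ℂ) : ℝ :=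
  Real.circleAverage (poissonKernel 0 w * fun ζ => L - Real.log ‖f ζ‖) 0 r

section
variable {f : ℂ → ℂ} {L : ℝ}

lemma circleIntegrable_log_norm_of_differentiableOn
    (hf : DifferentiableOn ℂ f (Metric.ball (0 : ℂ) 1)) {r : ℝ} (hr : 0 < r) (hr1 : r < 1) :
    CircleIntegrable (fun ζ => Real.log ‖f ζ‖) 0 r := by
  refine MeromorphicOn.circleIntegrable_log_norm ?_
  rw [abs_of_pos hr]
  exact ((hf.analyticOnNhd Metric.isOpen_ball).mono (Metric.sphere_subset_closedBall.trans
    (Metric.closedBall_subset_ball hr1))).meromorphicOn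

lemma poissonMean_eq (hf : DifferentiableOn ℂ f (Metric.ball (0 : ℂ) 1)) {r : ℝ} (hr : 0 < r)
    (hr1 : r < 1) {w : ℂ} (hw : ‖w‖ < r) (hfw : f w ≠ 0) :
    (∫⁻ a, truncGreen r w a ∂(zeroMeasure f)) ≠ ⊤ ∧ poissonMean f L r w = L - Real.log ‖f w‖ -
      (∫⁻ a, truncGreen r w a ∂(zeroMeasure f)).toReal := by
  have hfa : AnalyticOnNhd ℂ f (Metric.closedBall 0 r) :=
    (hf.analyticOnNhd Metric.isOpen_ball).mono (Metric.closedBall_subset_ball hr1)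
  obtain ⟨S, hS, h⟩ := hfa.poisson_jensen hr hw hfw
  rw [lintegral_truncGreen hr hr1 hw hS]
  refine ⟨ENNReal.ofReal_ne_top, ?_⟩
  rw [ENNReal.toReal_ofReal, h]
  swap
  · refine Finset.sum_nonneg fun u hu => ?_
    have h1 := ((hS u).mp hu).1
    exact mul_nonneg (by positivity) (discGreen_nonneg hr hw (by simpa using h1))
  have hPc := continuousOn_poissonKernel hr hw
  have hL : Real.circleAverage (poissonKernel 0 w * fun _ => L) 0 r = L :=
    InnerProductSpace.HarmonicOnNhd.circleAverage_poissonKernel_smul (f := fun _ => L)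
      (fun _ _ => InnerProductSpace.harmonicAt_const _) (by simpa using hw)
  have e : (poissonKernel 0 w * fun ζ => L - Real.log ‖f ζ‖) =
      (poissonKernel 0 w * fun _ => L) - poissonKernel 0 w * fun ζ => Real.log ‖f ζ‖ := by
    rw [← mul_sub]; rfl
  rw [poissonMean, e, Real.circleAverage_sub, hL]
  · ring
  · exact (circleIntegrable_const _ _ _).continuousOn_mul hPc
  · exact (circleIntegrable_log_norm_of_differentiableOn hf hr hr1).continuousOn_mul hPc

lemma poissonMean_nonneg (hL : ∀ z ∈ Metric.ball (0 : ℂ) 1, Real.log ‖f z‖ ≤ L) {r : ℝ}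
    (hr : 0 < r) (hr1 : r < 1) {w : ℂ} (hw : ‖w‖ < r) : 0 ≤ poissonMean f L r w := by
  refine Real.circleAverage_nonneg_of_nonneg fun ζ hζ => ?_
  have hζ' : ‖ζ‖ = r := by simpa [abs_of_pos hr] using hζ
  have h1 : 0 ≤ L - Real.log ‖f ζ‖ := sub_nonneg.mpr (hL ζ (by simpa [hζ'] using hr1))
  have h2 : 0 ≤ poissonKernel 0 w ζ := by
    rw [poissonKernel_def, sub_zero, sub_zero, hζ']
    have : 0 ≤ r ^ 2 - ‖w‖ ^ 2 := by nlinarith [norm_nonneg w]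
    positivity
  exact mul_nonneg h2 h1

lemma tendsto_truncGreen {w a : ℂ} (hw : ‖w‖ < 1) (ha : ‖a‖ < 1) (hne : w ≠ a) {r : ℕ → ℝ}
    (hr : Tendsto r atTop (𝓝 1)) :
    Tendsto (fun n => truncGreen (r n) w a) atTop
      (𝓝 (ENNReal.ofReal (-Real.log (pseudoDist w a)))) := by
  refine (ENNReal.tendsto_ofReal (tendsto_discGreen hw ha.le hne hr)).congr' ?_
  filter_upwards [hr.eventually (lt_mem_nhds ha)] with n hn
  rw [truncGreen, Set.indicator_of_mem (by simpa using hn.le)]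

lemma ae_zeroMeasure_norm_lt_and_ne (hf : DifferentiableOn ℂ f (Metric.ball (0 : ℂ) 1)) {w : ℂ}
    (hw : ‖w‖ < 1) (hfw : f w ≠ 0) : ∀ᵐ a ∂(zeroMeasure f), ‖a‖ < 1 ∧ w ≠ a := by
  obtain ⟨η, hη, -, h⟩ := exists_ae_zeroMeasure_le_norm_sub hf (by simpa using hw) hfw
  filter_upwards [h, ae_zeroMeasure_norm_lt f] with a h1 h2
  refine ⟨h2, ?_⟩
  rintro rfl
  rw [sub_self, norm_zero] at h1
  linarith

/-- Fatou's lemma: the Poisson mean of `L - log |f|` is nonnegative, so by Poisson–Jensen every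
truncated Green sum is at most `L - log |f w|`. -/
lemma lintegral_neg_log_pseudoDist_lt_top (hf : DifferentiableOn ℂ f (Metric.ball (0 : ℂ) 1))
    (hL : ∀ z ∈ Metric.ball (0 : ℂ) 1, Real.log ‖f z‖ ≤ L) {r : ℕ → ℝ}
    (hr0 : ∀ n, 0 < r n) (hr1 : ∀ n, r n < 1) (hr : Tendsto r atTop (𝓝 1)) {w : ℂ}
    (hw : ‖w‖ < 1) (hfw : f w ≠ 0) :
    ∫⁻ a, ENNReal.ofReal (-Real.log (pseudoDist w a)) ∂(zeroMeasure f) < ⊤ := by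
  have hae := ae_zeroMeasure_norm_lt_and_ne hf hw hfw
  calc ∫⁻ a, ENNReal.ofReal (-Real.log (pseudoDist w a)) ∂(zeroMeasure f)
      = ∫⁻ a, liminf (fun n => truncGreen (r n) w a) atTop ∂(zeroMeasure f) := by
        refine lintegral_congr_ae ?_
        filter_upwards [hae] with a ha
        exact (tendsto_truncGreen hw ha.1 ha.2 hr).liminf_eq.symm
    _ ≤ liminf (fun n => ∫⁻ a, truncGreen (r n) w a ∂(zeroMeasure f)) atTop :=
        lintegral_liminf_le fun n => measurable_truncGreen _ _
    _ ≤ ENNReal.ofReal (L - Real.log ‖f w‖) := by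
        refine liminf_le_of_frequently_le' (Eventually.frequently ?_)
        filter_upwards [hr.eventually (lt_mem_nhds hw)] with n hn
        obtain ⟨h1, h2⟩ := poissonMean_eq (L := L) hf (hr0 n) (hr1 n) hn hfw
        have h3 := poissonMean_nonneg hL (hr0 n) (hr1 n) hn
        rw [← ENNReal.ofReal_toReal h1]
        exact ENNReal.ofReal_le_ofReal (by linarith)
    _ < ⊤ := ENNReal.ofReal_lt_top

lemma tendsto_poissonMean (hf : DifferentiableOn ℂ f (Metric.ball (0 : ℂ) 1))
    (hL : ∀ z ∈ Metric.ball (0 : ℂ) 1, Real.log ‖f z‖ ≤ L) {r : ℕ → ℝ}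
    (hr0 : ∀ n, 0 < r n) (hr1 : ∀ n, r n < 1) (hr : Tendsto r atTop (𝓝 1)) {w : ℂ}
    (hw : ‖w‖ < 1) (hfw : f w ≠ 0) :
    Tendsto (fun n => poissonMean f L (r n) w) atTop (𝓝 (L - Real.log ‖f w‖ -
      (∫⁻ a, ENNReal.ofReal (-Real.log (pseudoDist w a)) ∂(zeroMeasure f)).toReal)) := by
  have hfin := lintegral_neg_log_pseudoDist_lt_top hf hL hr0 hr1 hr hw hfw
  have hae := ae_zeroMeasure_norm_lt_and_ne hf hw hfw
  have hev := hr.eventually (lt_mem_nhds hw)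
  have hlim : Tendsto (fun n => ∫⁻ a, truncGreen (r n) w a ∂(zeroMeasure f)) atTop
      (𝓝 (∫⁻ a, ENNReal.ofReal (-Real.log (pseudoDist w a)) ∂(zeroMeasure f))) := by
    refine tendsto_lintegral_filter_of_dominated_convergence
      (fun a => ENNReal.ofReal (-Real.log (pseudoDist w a)))
      (Eventually.of_forall fun n => measurable_truncGreen _ _) ?_ hfin.ne ?_
    · filter_upwards [hev] with n hn
      filter_upwards [hae] with a ha
      by_cases hb : a ∈ Metric.closedBall (0 : ℂ) (r n)
      · rw [truncGreen, Set.indicator_of_mem hb]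
        exact ENNReal.ofReal_le_ofReal
          (discGreen_le (hr0 n) (hr1 n) hn (by simpa using hb) ha.2)
      · rw [truncGreen, Set.indicator_of_notMem hb]
        exact zero_le
    · filter_upwards [hae] with a ha
      exact tendsto_truncGreen hw ha.1 ha.2 hr
  refine Tendsto.congr' ?_ (tendsto_const_nhds.sub
    ((ENNReal.tendsto_toReal hfin.ne).comp hlim))
  filter_upwards [hev] with n hn
  exact (poissonMean_eq hf (hr0 n) (hr1 n) hn hfw).2.symm

end

/-! ### The boundary measure as a weak limit. -/

/-- The measure on the unit circle with density `h` with respect to arc length. -/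
noncomputable def circleDensity (h : ℝ → ℝ) : Measure ℂ :=
  ((volume.restrict (Set.Ioc 0 (2 * Real.pi))).withDensity fun θ => ENNReal.ofReal (h θ)).map
    (polarPt 1)

lemma circleDensity_univ {h : ℝ → ℝ} (h0 : ∀ θ, 0 ≤ h θ)
    (hi : IntervalIntegrable h volume 0 (2 * Real.pi)) :
    circleDensity h Set.univ = ENNReal.ofReal (∫ θ in (0 : ℝ)..(2 * Real.pi), h θ) := by
  rw [circleDensity, Measure.map_apply (continuous_polarPt 1).measurable .univ, Set.preimage_univ,
    withDensity_apply _ .univ, Measure.restrict_univ,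
    intervalIntegral.integral_of_le Real.two_pi_pos.le, ofReal_integral_eq_lintegral_ofReal
      ((intervalIntegrable_iff_integrableOn_Ioc_of_le Real.two_pi_pos.le).mp hi) (ae_of_all _ h0)]

lemma circleDensity_compl_sphere (h : ℝ → ℝ) :
    circleDensity h (Metric.sphere (0 : ℂ) 1)ᶜ = 0 := by
  rw [circleDensity, Measure.map_apply (continuous_polarPt 1).measurable
    Metric.isClosed_sphere.measurableSet.compl]
  have : polarPt 1 ⁻¹' (Metric.sphere (0 : ℂ) 1)ᶜ = ∅ := by
    ext θ
    simp [norm_polarPt zero_le_one]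
  rw [this, measure_empty]

lemma integral_circleDensity {h : ℝ → ℝ} (hm : Measurable h) (h0 : ∀ θ, 0 ≤ h θ) {g : ℂ → ℝ}
    (hg : Measurable g) :
    ∫ ζ, g ζ ∂(circleDensity h) = ∫ θ in (0 : ℝ)..(2 * Real.pi), h θ * g (polarPt 1 θ) := by
  rw [circleDensity, integral_map (continuous_polarPt 1).measurable.aemeasurable
    hg.aestronglyMeasurable, integral_withDensity_eq_integral_toReal_smul hm.ennreal_ofReal
    (ae_of_all _ fun _ => ENNReal.ofReal_lt_top),
    intervalIntegral.integral_of_le Real.two_pi_pos.le]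
  refine integral_congr_ae (ae_of_all _ fun θ => ?_)
  simp only [ENNReal.toReal_ofReal (h0 θ), smul_eq_mul]

/-- The Poisson kernel of the unit disc, continued to a bounded continuous function. -/
noncomputable def poissonBounded (w : ℂ) (ζ : ℂ) : ℝ :=
  (1 - ‖w‖ ^ 2) / max ((1 - ‖w‖) / 2) ‖ζ - w‖ ^ 2

lemma continuous_poissonBounded {w : ℂ} (hw : ‖w‖ < 1) : Continuous (poissonBounded w) := by
  unfold poissonBounded
  refine Continuous.div (by fun_prop) (by fun_prop) fun ζ => ?_
  have : 0 < max ((1 - ‖w‖) / 2) ‖ζ - w‖ := lt_max_of_lt_left (by linarith)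
  positivity

lemma poissonBounded_nonneg {w : ℂ} (hw : ‖w‖ < 1) (ζ : ℂ) : 0 ≤ poissonBounded w ζ := by
  have : 0 ≤ 1 - ‖w‖ ^ 2 := by nlinarith [norm_nonneg w]
  exact div_nonneg this (by positivity)

lemma poissonBounded_le {w : ℂ} (hw : ‖w‖ < 1) (ζ : ℂ) :
    poissonBounded w ζ ≤ (1 - ‖w‖ ^ 2) / ((1 - ‖w‖) / 2) ^ 2 := by
  have h1 : 0 ≤ 1 - ‖w‖ ^ 2 := by nlinarith [norm_nonneg w]
  have h2 : 0 < (1 - ‖w‖) / 2 := by linarith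
  unfold poissonBounded
  gcongr
  exact le_max_left _ _

lemma poissonBounded_of_norm_eq_one {w ζ : ℂ} (hw : ‖w‖ < 1) (hζ : ‖ζ‖ = 1) :
    poissonBounded w ζ = (1 - ‖w‖ ^ 2) / ‖ζ - w‖ ^ 2 := by
  have := norm_sub_norm_le ζ w
  rw [poissonBounded, max_eq_right]
  linarith

lemma abs_div_sq_sub_div_sq_le {A B a b c d : ℝ} (hc : 0 < c) (ha : c ≤ a) (hb : c ≤ b)
    (ha2 : a ≤ 2) (hb2 : b ≤ 2) (hab : |a - b| ≤ d) (hAB : |A - B| ≤ 2 * d) (hB : |B| ≤ 1) :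
    |A / a ^ 2 - B / b ^ 2| ≤ (2 / c ^ 2 + 4 / c ^ 4) * d := by
  have ha0 : 0 < a := hc.trans_le ha
  have hb0 : 0 < b := hc.trans_le hb
  have hd : 0 ≤ d := (abs_nonneg _).trans hab
  have e : A / a ^ 2 - B / b ^ 2 = (A - B) / a ^ 2 + B * ((b - a) * (b + a)) / (a ^ 2 * b ^ 2) := by
    field_simp
    ring
  rw [e, add_mul]
  refine (abs_add_le _ _).trans (add_le_add ?_ ?_)
  · rw [abs_div, abs_of_pos (by positivity : 0 < a ^ 2), div_mul_eq_mul_div]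
    gcongr
  · rw [abs_div, abs_of_pos (by positivity : 0 < a ^ 2 * b ^ 2), div_mul_eq_mul_div, abs_mul,
      abs_mul, abs_sub_comm, abs_of_pos (by positivity : 0 < b + a)]
    have h1 : c ^ 4 ≤ a ^ 2 * b ^ 2 := by
      calc c ^ 4 = c ^ 2 * c ^ 2 := by ring
        _ ≤ _ := by gcongr
    have h2 : |B| * (|a - b| * (b + a)) ≤ 1 * (d * 4) := by
      have : b + a ≤ 4 := by linarith
      gcongr
    refine div_le_div₀ (by positivity) (by linarith) (by positivity) h1

/-- The densities live on the unit circle, whereas the Poisson kernel is that of the circle of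
radius `r`. The error of exchanging the kernels is `O(1 - r)` uniformly in `ζ`, because both
denominators stay above `(1 - |w|)/2` before squaring. -/
lemma abs_poissonKernel_sub_poissonBounded_le {w ζ : ℂ} (hw : ‖w‖ < 1) (hζ : ‖ζ‖ = 1) {r : ℝ}
    (hr : (1 + ‖w‖) / 2 ≤ r) (hr1 : r < 1) :
    |poissonKernel 0 w (r * ζ) - poissonBounded w ζ| ≤
      (2 / ((1 - ‖w‖) / 2) ^ 2 + 4 / ((1 - ‖w‖) / 2) ^ 4) * (1 - r) := by
  have hw0 := norm_nonneg w
  have hr0 : 0 < r := by linarith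
  have hrζ : ‖(r : ℂ) * ζ‖ = r := by simp [hζ, abs_of_pos hr0]
  rw [poissonBounded_of_norm_eq_one hw hζ, poissonKernel_def, sub_zero, sub_zero, hrζ]
  have h1 := norm_sub_norm_le (r * ζ) w
  have h2 := norm_sub_norm_le ζ w
  have h3 := norm_sub_le (r * ζ) w
  have h4 := norm_sub_le ζ w
  rw [hrζ] at h1 h3
  rw [hζ] at h2 h4
  refine abs_div_sq_sub_div_sq_le (by linarith) (by linarith) (by linarith) (by linarith)
    (by linarith) ?_ ?_ ?_
  · refine (abs_norm_sub_norm_le _ _).trans ?_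
    rw [sub_sub_sub_cancel_right, ← sub_one_mul, norm_mul, hζ, mul_one, ← Complex.ofReal_one,
      ← Complex.ofReal_sub, Complex.norm_real, Real.norm_eq_abs, abs_sub_comm,
      abs_of_pos (by linarith)]
  · rw [abs_le]; constructor <;> nlinarith
  · rw [abs_le]; constructor <;> nlinarith

section
variable {f : ℂ → ℂ} {L : ℝ}

lemma poissonMean_eq_integral (hf : DifferentiableOn ℂ f (Metric.ball (0 : ℂ) 1))
    (hL : ∀ z ∈ Metric.ball (0 : ℂ) 1, Real.log ‖f z‖ ≤ L) {r : ℝ} (hr : 0 < r) (hr1 : r < 1)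
    (w : ℂ) : ∫ ζ, poissonKernel 0 w (r * ζ)
      ∂(circleDensity fun θ => L - Real.log ‖f (polarPt r θ)‖) =
        2 * Real.pi * poissonMean f L r w := by
  have hpk : Measurable fun ζ : ℂ => poissonKernel 0 w (r * ζ) := by
    simp only [poissonKernel_def]
    fun_prop
  have hm := (continuous_comp_polarPt hf hr.le hr1).measurable
  rw [integral_circleDensity (hm.norm.log.const_sub L) _ hpk, poissonMean, Real.circleAverage_def, smul_eq_mul,
    mul_inv_cancel_left₀ Real.two_pi_pos.ne']
  · refine intervalIntegral.integral_congr fun θ _ => ?_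
    have e : circleMap 0 r θ = polarPt r θ := circleMap_zero r θ
    have e2 : (r : ℂ) * polarPt 1 θ = polarPt r θ := by simp [polarPt]
    simp only [Pi.mul_apply, e, e2]
    ring
  · intro θ
    refine sub_nonneg.mpr (hL _ ?_)
    rw [mem_ball_zero_iff, norm_polarPt hr.le]
    exact hr1

/-- A mass bound uniform in `r`: the Poisson kernel with pole `w` is bounded below on these circles,
and the Poisson mean is at most `L - log |f w|`. -/
lemma integral_log_norm_le (hf : DifferentiableOn ℂ f (Metric.ball (0 : ℂ) 1))
    (hL : ∀ z ∈ Metric.ball (0 : ℂ) 1, Real.log ‖f z‖ ≤ L) {w : ℂ} (hw : ‖w‖ < 1) (hfw : f w ≠ 0)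
    {r : ℝ} (hr : (1 + ‖w‖) / 2 ≤ r) (hr1 : r < 1) :
    IntervalIntegrable (fun θ => L - Real.log ‖f (polarPt r θ)‖) volume 0 (2 * Real.pi) ∧
    ∫ θ in (0 : ℝ)..(2 * Real.pi), (L - Real.log ‖f (polarPt r θ)‖) ≤
      2 * Real.pi * (L - Real.log ‖f w‖) / ((((1 + ‖w‖) / 2) ^ 2 - ‖w‖ ^ 2) / 4) := by
  have hw0 := norm_nonneg w
  have hr0 : 0 < r := by linarith
  have hwr : ‖w‖ < r := by linarith
  have hc : 0 < (((1 + ‖w‖) / 2) ^ 2 - ‖w‖ ^ 2) / 4 := by nlinarith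
  have hI : CircleIntegrable (fun ζ => L - Real.log ‖f ζ‖) 0 r :=
    (circleIntegrable_const L 0 r).sub (circleIntegrable_log_norm_of_differentiableOn hf hr0 hr1)
  have hI' : IntervalIntegrable (fun θ => L - Real.log ‖f (polarPt r θ)‖) volume 0
      (2 * Real.pi) := by
    have h := hI
    rw [CircleIntegrable] at h
    simp only [circleMap_zero] at h
    exact h
  refine ⟨hI', ?_⟩
  rw [le_div_iff₀' hc]
  obtain ⟨h1, h2⟩ := poissonMean_eq (L := L) hf hr0 hr1 hwr hfw
  have h3 : poissonMean f L r w ≤ L - Real.log ‖f w‖ := by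
    rw [h2]
    linarith [ENNReal.toReal_nonneg (a := ∫⁻ a, truncGreen r w a ∂(zeroMeasure f))]
  refine le_trans ?_ (mul_le_mul_of_nonneg_left h3 Real.two_pi_pos.le)
  rw [poissonMean, Real.circleAverage_def, smul_eq_mul, mul_inv_cancel_left₀ Real.two_pi_pos.ne',
    ← intervalIntegral.integral_const_mul]
  refine intervalIntegral.integral_mono_on Real.two_pi_pos.le (hI'.const_mul _)
    (hI.continuousOn_mul (continuousOn_poissonKernel hr0 hwr)) fun θ _ => ?_
  have e : circleMap 0 r θ = polarPt r θ := circleMap_zero r θ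
  have hn := norm_polarPt hr0.le θ
  simp only [Pi.mul_apply, e]
  refine mul_le_mul_of_nonneg_right ?_ (sub_nonneg.mpr (hL _ (by simpa [hn] using hr1)))
  rw [poissonKernel_def, sub_zero, sub_zero, hn]
  have h4 := norm_sub_le (polarPt r θ) w
  have h5 := norm_sub_norm_le (polarPt r θ) w
  rw [hn] at h4 h5
  have h6 : 0 < ‖polarPt r θ - w‖ := by linarith
  refine div_le_div₀ (by nlinarith) (by nlinarith) (by positivity) (by nlinarith)

/-- The kernel with pole `w` is at least `(1 - |w|²)/4`, so `1 - |ζ|` is at most a constant times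
the Green function. A finite Green potential at one point thus gives the Blaschke condition. -/
lemma lintegral_one_sub_norm_lt_top (hf : DifferentiableOn ℂ f (Metric.ball (0 : ℂ) 1)) {w : ℂ}
    (hw : ‖w‖ < 1) (hfw : f w ≠ 0)
    (h : ∫⁻ a, ENNReal.ofReal (-Real.log (pseudoDist w a)) ∂(zeroMeasure f) < ⊤) :
    ∫⁻ ζ, ENNReal.ofReal (1 - ‖ζ‖) ∂(zeroMeasure f) < ⊤ := by
  have hw0 := norm_nonneg w
  have hc : 0 < (1 - ‖w‖ ^ 2) / 8 := by nlinarith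
  have hle : ∫⁻ ζ, ENNReal.ofReal (1 - ‖ζ‖) ∂(zeroMeasure f) ≤
      ∫⁻ a, ENNReal.ofReal (((1 - ‖w‖ ^ 2) / 8)⁻¹) *
        ENNReal.ofReal (-Real.log (pseudoDist w a)) ∂(zeroMeasure f) := by
    refine lintegral_mono_ae ?_
    filter_upwards [ae_zeroMeasure_norm_lt_and_ne hf hw hfw] with a ha
    rw [← ENNReal.ofReal_mul (by positivity)]
    refine ENNReal.ofReal_le_ofReal ?_
    rw [inv_mul_eq_div, le_div_iff₀' hc]
    refine le_trans ?_ (boxKernel_mul_le_neg_log hw ha.1.le ha.2)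
    have h1 : (1 - ‖w‖ ^ 2) / 4 ≤ boxKernel w a := by
      have h2 := norm_one_sub_mul_conj_le_two hw.le ha.1.le
      have h3 := norm_one_sub_mul_conj_pos hw ha.1.le
      unfold boxKernel
      gcongr
      · nlinarith
      · nlinarith
    nlinarith [ha.1]
  refine hle.trans_lt ?_
  rw [lintegral_const_mul' _ _ ENNReal.ofReal_ne_top]
  exact ENNReal.mul_lt_top ENNReal.ofReal_lt_top h

/-- Densities of bounded mass on the circle have a limit measure along an ultrafilter. -/
lemma exists_tendsto_integral_circleDensity {h : ℕ → ℝ → ℝ} {B : ℝ} (h0 : ∀ n θ, 0 ≤ h n θ)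
    (hi : ∀ n, IntervalIntegrable (h n) volume 0 (2 * Real.pi))
    (hB : ∀ n, ∫ θ in (0 : ℝ)..(2 * Real.pi), h n θ ≤ B) :
    ∃ ψ : Measure ℂ, IsFiniteMeasure ψ ∧ ψ (Metric.sphere (0 : ℂ) 1)ᶜ = 0 ∧
      ∃ U : Filter ℕ, U.NeBot ∧ U ≤ atTop ∧ ∀ g : BoundedContinuousFunction ℂ ℝ,
        Tendsto (fun n => ∫ ζ, g ζ ∂(circleDensity (h n))) U (𝓝 (∫ ζ, g ζ ∂ψ)) := by
  have hmass : ∀ n, circleDensity (h n) Set.univ ≤ ENNReal.ofReal B := fun n => by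
    rw [circleDensity_univ (h0 n) (hi n)]
    exact ENNReal.ofReal_le_ofReal (hB n)
  have hfin : ∀ n, IsFiniteMeasure (circleDensity (h n)) := fun n =>
    ⟨(hmass n).trans_lt ENNReal.ofReal_lt_top⟩
  set ν : ℕ → FiniteMeasure ℂ := fun n => ⟨circleDensity (h n), hfin n⟩ with hν
  have hcomp := isCompact_setOfPred_finiteMeasure_le_of_isCompact B.toNNReal
    (isCompact_sphere (0 : ℂ) 1)
  have hmem : ∀ n, ν n ∈ {μ : FiniteMeasure ℂ | μ.mass ≤ B.toNNReal ∧
      μ (Metric.sphere (0 : ℂ) 1)ᶜ = 0} := by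
    refine fun n => ⟨?_, ?_⟩
    · rw [← ENNReal.coe_le_coe, FiniteMeasure.ennreal_mass]
      exact hmass n
    · rw [FiniteMeasure.null_iff_toMeasure_null]
      exact circleDensity_compl_sphere _
  -- Measures of bounded mass carried by the circle form a weakly compact set; a limit along an
  -- ultrafilter avoids extracting a subsequence.
  obtain ⟨ψ, hψ, hlim⟩ := hcomp.ultrafilter_le_nhds' ((hyperfilter ℕ).map ν)
    (Ultrafilter.mem_map.mpr (univ_mem' hmem))
  refine ⟨ψ, inferInstance, (FiniteMeasure.null_iff_toMeasure_null _ _).mp hψ.2, hyperfilter ℕ,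
    inferInstance, Nat.hyperfilter_le_atTop, fun g => ?_⟩
  exact FiniteMeasure.tendsto_iff_forall_integral_tendsto.mp hlim g

/-- A bounded analytic function in the disc has a boundary measure. -/
theorem exists_isBoundaryMeasure (hf : DifferentiableOn ℂ f (Metric.ball (0 : ℂ) 1))
    (hbdd : ∃ M : ℝ, ∀ z ∈ Metric.ball (0 : ℂ) 1, ‖f z‖ ≤ M)
    (hne : ∃ z ∈ Metric.ball (0 : ℂ) 1, f z ≠ 0) : ∃ ψ : Measure ℂ, IsBoundaryMeasure f ψ := by
  obtain ⟨M, hM⟩ := hbdd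
  obtain ⟨w₀, hw₀, hfw₀⟩ := hne
  rw [mem_ball_zero_iff] at hw₀
  -- The maximum with `1` makes `L ≥ 0`, which is needed at the zeros of `f`, where `log 0 = 0`.
  set L := Real.log (max M 1) with hLdef
  have hL : ∀ z ∈ Metric.ball (0 : ℂ) 1, Real.log ‖f z‖ ≤ L := by
    intro z hz
    rcases eq_or_ne (f z) 0 with h | h
    · rw [h, norm_zero, Real.log_zero]
      exact Real.log_nonneg (le_max_right _ _)
    · exact Real.log_le_log (norm_pos_iff.mpr h) ((hM z hz).trans (le_max_left _ _))
  have hw0 := norm_nonneg w₀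
  -- The radii start at `(1 + |w₀|)/2`, so that the uniform mass bound at `w₀` applies to all of
  -- them.
  set r : ℕ → ℝ := fun n => 1 - (1 - ‖w₀‖) / 2 * (1 / ((n : ℝ) + 1)) with hrdef
  have hpos : ∀ n : ℕ, 0 < 1 / ((n : ℝ) + 1) := fun n => by positivity
  have hle : ∀ n : ℕ, 1 / ((n : ℝ) + 1) ≤ 1 := fun n => by
    rw [div_le_one (by positivity)]
    linarith [Nat.cast_nonneg (α := ℝ) n]
  have hr1 : ∀ n, r n < 1 := fun n => by
    simp only [hrdef]
    nlinarith [hpos n]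
  have hrw : ∀ n, (1 + ‖w₀‖) / 2 ≤ r n := fun n => by
    simp only [hrdef]
    nlinarith [hle n]
  have hr0 : ∀ n, 0 < r n := fun n => by linarith [hrw n]
  have hr : Tendsto r atTop (𝓝 1) := by
    have := (tendsto_one_div_add_atTop_nhds_zero_nat (𝕜 := ℝ)).const_mul ((1 - ‖w₀‖) / 2)
    simpa [hrdef] using this.const_sub 1
  set h : ℕ → ℝ → ℝ := fun n θ => L - Real.log ‖f (polarPt (r n) θ)‖ with hh
  have h0 : ∀ n θ, 0 ≤ h n θ := fun n θ => by
    refine sub_nonneg.mpr (hL _ ?_)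
    rw [mem_ball_zero_iff, norm_polarPt (hr0 n).le]
    exact hr1 n
  set B := 2 * Real.pi * (L - Real.log ‖f w₀‖) / ((((1 + ‖w₀‖) / 2) ^ 2 - ‖w₀‖ ^ 2) / 4)
  have hi := fun n => (integral_log_norm_le hf hL hw₀ hfw₀ (hrw n) (hr1 n)).1
  have hB := fun n => (integral_log_norm_le hf hL hw₀ hfw₀ (hrw n) (hr1 n)).2
  obtain ⟨ψ, hψ, hcar, U, hU, hUle, hlim⟩ := exists_tendsto_integral_circleDensity h0 hi hB
  have hsph : ∀ {μ : Measure ℂ}, μ (Metric.sphere (0 : ℂ) 1)ᶜ = 0 → ∀ᵐ ζ ∂μ, ‖ζ‖ = 1 := by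
    intro μ hμ
    have : ∀ᵐ ζ ∂μ, ζ ∈ Metric.sphere (0 : ℂ) 1 := by
      rw [ae_iff]; exact hμ
    simpa using this
  refine ⟨ψ, hψ, hcar, lintegral_one_sub_norm_lt_top hf hw₀ hfw₀
    (lintegral_neg_log_pseudoDist_lt_top hf hL hr0 hr1 hr hw₀ hfw₀), L, fun w hw hfw => ?_⟩
  rw [mem_ball_zero_iff] at hw
  have hA := (tendsto_poissonMean hf hL hr0 hr1 hr hw hfw).mono_left hUle
  have hB0 : 0 ≤ B := le_trans
    (intervalIntegral.integral_nonneg Real.two_pi_pos.le fun θ _ => h0 0 θ) (hB 0)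
  -- Weak convergence is tested against bounded continuous functions on the whole plane, hence the
  -- truncated Poisson kernel, which is the true one on the circle.
  set g : BoundedContinuousFunction ℂ ℝ := BoundedContinuousFunction.ofNormedAddCommGroup
    (poissonBounded w) (continuous_poissonBounded hw) ((1 - ‖w‖ ^ 2) / ((1 - ‖w‖) / 2) ^ 2)
    (fun ζ => by
      rw [Real.norm_of_nonneg (poissonBounded_nonneg hw ζ)]
      exact poissonBounded_le hw ζ)
  have hgl := hlim g
  set D := 2 / ((1 - ‖w‖) / 2) ^ 2 + 4 / ((1 - ‖w‖) / 2) ^ 4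
  have hdiff : Tendsto (fun n => ∫ ζ, poissonKernel 0 w (r n * ζ) ∂(circleDensity (h n)) -
      ∫ ζ, g ζ ∂(circleDensity (h n))) atTop (𝓝 0) := by
    have hz : Tendsto (fun n => D * (1 - r n) * B) atTop (𝓝 0) := by
      simpa using ((hr.const_sub 1).const_mul D).mul_const B
    refine squeeze_zero_norm' ?_ hz
    filter_upwards [hr.eventually (le_mem_nhds (show (1 + ‖w‖) / 2 < 1 by linarith))] with n hn
    have hmass := circleDensity_univ (h0 n) (hi n)
    have : IsFiniteMeasure (circleDensity (h n)) := ⟨by rw [hmass]; exact ENNReal.ofReal_lt_top⟩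
    have hbd : ∀ᵐ ζ ∂(circleDensity (h n)),
        ‖poissonKernel 0 w (r n * ζ) - g ζ‖ ≤ D * (1 - r n) := by
      filter_upwards [hsph (circleDensity_compl_sphere (h n))] with ζ hζ
      exact abs_poissonKernel_sub_poissonBounded_le hw hζ hn (hr1 n)
    have hpk : Measurable fun ζ : ℂ => poissonKernel 0 w (r n * ζ) := by
      simp only [poissonKernel_def]
      fun_prop
    have hgi : Integrable (fun ζ => g ζ) (circleDensity (h n)) := g.integrable _
    have hd : Integrable (fun ζ => poissonKernel 0 w (r n * ζ) - g ζ) (circleDensity (h n)) :=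
      Integrable.of_bound (hpk.sub g.continuous.measurable).aestronglyMeasurable _ hbd
    have hpi : Integrable (fun ζ => poissonKernel 0 w (r n * ζ)) (circleDensity (h n)) := by
      exact (hd.add hgi).congr (ae_of_all _ fun ζ => sub_add_cancel _ _)
    rw [← integral_sub hpi hgi]
    refine (norm_integral_le_of_norm_le_const hbd).trans ?_
    have : (circleDensity (h n)).real Set.univ ≤ B := by
      rw [Measure.real, hmass]
      exact ENNReal.toReal_le_of_le_ofReal hB0 (ENNReal.ofReal_le_ofReal (hB n))
    have hD : 0 ≤ D := by positivity
    have := hr1 n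
    gcongr
  have hsum := hgl.add (hdiff.mono_left hUle)
  simp only [add_sub_cancel, add_zero] at hsum
  have hsum' : Tendsto (fun n => 2 * Real.pi * poissonMean f L (r n) w) U
      (𝓝 (∫ ζ, g ζ ∂ψ)) :=
    hsum.congr fun n => poissonMean_eq_integral hf hL (hr0 n) (hr1 n) w
  -- The same Poisson means converge to the integral against `ψ` and, by Poisson–Jensen, to `2π`
  -- times `L - log |f w|` minus the Green potential; this is the representation with `C = L`.
  have heq := tendsto_nhds_unique hsum' (hA.const_mul (2 * Real.pi))
  have hg : ∫ ζ, g ζ ∂ψ = ∫ ζ, (1 - ‖w‖ ^ 2) / ‖ζ - w‖ ^ 2 ∂ψ := by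
    refine integral_congr_ae ?_
    filter_upwards [hsph hcar] with ζ hζ
    exact poissonBounded_of_norm_eq_one hw hζ
  rw [integral_log_pseudoDist f hw, ← hg, heq, ← mul_assoc, one_div,
    inv_mul_cancel₀ Real.two_pi_pos.ne']
  ring

end

theorem theorem2 (f : ℂ → ℂ)
    (hf : DifferentiableOn ℂ f (Metric.ball (0 : ℂ) 1))
    (hbdd : ∃ M : ℝ, ∀ z ∈ Metric.ball (0 : ℂ) 1, ‖f z‖ ≤ M)
    (hne : ∃ z ∈ Metric.ball (0 : ℂ) 1, f z ≠ 0)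
    (γ : ℝ) (hγ : γ ∈ Set.Ioc (0 : ℝ) 1) (p : ℝ) (hp : 1 < p) :
    (∃ Λ : Measure ℂ, IsCompleteMeasure f Λ) ∧
    ∀ Λ : Measure ℂ, IsCompleteMeasure f Λ →
      ((fun r : ℝ => logMean p f r) =O[𝓝[<] 1] (fun r : ℝ => (1 - r) ^ (γ - 1)) ↔
        ∃ K : ℝ, ∀ δ ∈ Set.Ioo (0 : ℝ) 1, boxMean p Λ δ ≤ K * δ ^ γ) := by
  obtain ⟨ψ, hψ⟩ := exists_isBoundaryMeasure hf hbdd hne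
  refine ⟨⟨completeMeasure f ψ, ψ, hψ, rfl⟩, ?_⟩
  rintro Λ ⟨ψ', hψ', rfl⟩
  exact logMean_isBigO_iff_boxMean_le hf hne hψ' hγ hp
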